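/- **Setting.** There are $N$ servers, $K\ge 1$ messages and $M\ge 1$ communication links, given by a binary $N\times M$ matrix $B_X$; the $m$-th link is $\mathcal X_m=\{n: B_X(n,m)=1\}$. Put $\mathcal X=\{\mathcal X_1,\dots,\mathcal X_M\}$ and $\lambda=\max_n\sum_{m=1}^M(1-B_X(n,m))$. *Grouping.* A feasible grouping is a binary $\lceil N/2\rceil\times N$ matrix $\Lambda$ with rows $\Lambda_i$ such that: every nonzero row satisfies $\Lambda_iB_X^c\ge \mathbf 1$ entrywise, where $B_X^c=\mathbf 1-B_X$ (no group is contained in a link); $\sum_j\Lambda(i,j)\ne 1$ for all $i$; and distinct rows are orthogonal. The groups are the supports of the nonzero rows. An optimal grouping is a feasible one with the largest number of groups; let $g$ be this number and $M_i$ the sizes of the groups $G_1,\dots,G_g$ of a fixed optimal grouping. *Schemes and capacity.* Let $\mathbb F_q$ be a finite field. A scheme has a message length $L\ge1$ and independent random variables: the messages $W_1,\dots,W_K$, independent and uniform on $\mathbb F_q^L$, a storage noise $Z$, a user key $U$, and the index $\Theta$ of the wanted message, uniform on $[K]$. Server $n$ stores $S_n=\Psi_n(W_{[K]},Z)\in\mathbb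 F_q^{a_n}$; its query for message $k$ is a function $Q_n^{[k]}$ of $k$ and $U$ (so the queries are independent of the messages and of the storage); its answer is $A_n^{[k]}=\phi_n(Q_n^{[k]},S_n)\in\mathbb F_q^{b_n}$, where $\phi_n$ does not depend on $k$. All alphabets are finite. Given a family $\mathcal T$ of colluding sets, a scheme is admissible if - (security) $I(W_{[K]};S_n)=0$ for each server $n$ and $I(W_{[K]};S_{X})=0$ for each link $X\in\mathcal X$; - (privacy) $I(\Theta;Q_n^{[\Theta]})=0$ for each server $n$ and $I(\Theta;Q_T^{[\Theta]})=0$ for each $T\in\mathcal T$; - (decodability) $H(W_k\mid A_{[N]}^{[k]},Q_{[N]}^{[k]})=0$ for each $k\in[K]$. It achieves the rate $R$ if $R\le L/\sum_{n=1}^N H(A_n^{[k]})$ for each $k$, entropies being in $q$-ary units. The capacity $C(N,K,\mathcal X,\mathcal T)$ is the supremum of the rates achieved by admissible schemes, over all $L$. Put $C_{PIR}(g,K)=\left(1+\frac1g+\dots+\frac1{g^{K-1}}\right)^{-1}$ and $\eta_K(\mathcal X_m)=\sum_{i=1}^{K-1}\left(\frac{1}{N-|\mathcal X_m|}\right)^i$.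 **Theorem.** Suppose that $g\ge1$, that $\frac{\lambda}{M}=\frac{g}{\sum_iM_i}$, and that $|\mathcal X_m|=N-g$ for all $m\in[M]$. Let $\mathcal T=\{G_1,\dots,G_g\}$. Then, for every finite field $\mathbb F_q$, $$C(N,K,\mathcal X,\mathcal T)=\frac{\lambda}{M\left(1+\eta_K(\mathcal X_1)\right)}=\frac{\lambda}{M}\,C_{PIR}(N-|\mathcal X_1|,K)=\frac{\lambda}{M}\,C_{PIR}(g,K).$$ -/

import Mathlib

namespace AXPIR

noncomputable section

/-! ### Entropies of discrete random variables, in `q`-ary units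

A random variable is a function on the sample space `Ω` of a `PMF`. -/

/-- The entropy `H(X)`, with logarithms to base `q`. -/
def entropy (q : ℕ) {Ω β : Type} [Fintype β] (P : PMF Ω) (X : Ω → β) : ℝ :=
  (∑ x, Real.negMulLog ((P.map X) x).toReal) / Real.log q

/-- The conditional entropy `H(X | Y) = H(X, Y) - H(Y)`. -/
def condEntropy (q : ℕ) {Ω β γ : Type} [Fintype β] [Fintype γ] (P : PMF Ω)
    (X : Ω → β) (Y : Ω → γ) : ℝ :=
  entropy q P (fun ω => (X ω, Y ω)) - entropy q P Y

/-- The mutual information `I(X ; Y) = H(X) + H(Y) - H(X, Y)`. -/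
def mutualInfo (q : ℕ) {Ω β γ : Type} [Fintype β] [Fintype γ] (P : PMF Ω)
    (X : Ω → β) (Y : Ω → γ) : ℝ :=
  entropy q P X + entropy q P Y - entropy q P (fun ω => (X ω, Y ω))

/-! ### Communication matrices and groupings of the servers -/

/-- All entries are `0` or `1`. -/
def IsBinary {m n : Type} (A : Matrix m n ℕ) : Prop := ∀ i j, A i j = 0 ∨ A i j = 1

/-- The binary complement of a binary matrix. -/
def compl {m n : Type} (A : Matrix m n ℕ) : Matrix m n ℕ := fun i j => 1 - A i j

/-- The set of servers in the `m`-th communication link. -/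
def link {N M : ℕ} (B : Matrix (Fin N) (Fin M) ℕ) (m : Fin M) : Finset (Fin N) :=
  Finset.univ.filter fun n => B n m = 1

/-- The family of all communication links. -/
def links {N M : ℕ} (B : Matrix (Fin N) (Fin M) ℕ) : Finset (Finset (Fin N)) :=
  Finset.univ.image (link B)

/-- `max_n ∑_m (1 - B(n, m))`: the largest number of links that one server does not belong to. -/
def lam {N M : ℕ} (B : Matrix (Fin N) (Fin M) ℕ) : ℕ :=
  Finset.univ.sup fun n => ∑ m, compl B n m

/-- A similarity matrix: the `i`-th row is the indicator of the `i`-th group, or zero if the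
row is not used. -/
abbrev SimilarityMatrix (N : ℕ) : Type := Matrix (Fin ⌈(N : ℚ) / 2⌉₊) (Fin N) ℕ

open scoped Classical in
/-- The number of nonzero rows, that is, the number of groups. -/
def numGroups {N : ℕ} (Λ : SimilarityMatrix N) : ℕ :=
  (Finset.univ.filter fun i => Matrix.row Λ i ≠ 0).card

/-- The `i`-th group of servers. -/
def group {N : ℕ} (Λ : SimilarityMatrix N) (i : Fin ⌈(N : ℚ) / 2⌉₊) : Finset (Fin N) :=
  Finset.univ.filter fun j => Λ i j = 1

open scoped Classical in
/-- The family of all groups. -/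
def groups {N : ℕ} (Λ : SimilarityMatrix N) : Finset (Finset (Fin N)) :=
  (Finset.univ.filter fun i => Matrix.row Λ i ≠ 0).image (group Λ)

/-- The constraints of the grouping problem. The security constraint concerns the rows that are
in use, since a zero row is not a group. -/
structure IsFeasible {N M : ℕ} (B : Matrix (Fin N) (Fin M) ℕ) (Λ : SimilarityMatrix N) :
    Prop where
  binary : IsBinary Λ
  /-- Every group has, for every link, a member outside this link. -/
  secure : ∀ i, Matrix.row Λ i ≠ 0 → ∀ m, 1 ≤ (Λ * compl B) i m
  no_singleton : ∀ i, ∑ j, Λ i j ≠ 1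
  orthogonal : ∀ i j, i ≠ j → Matrix.row Λ i ⬝ᵥ Matrix.row Λ j = 0

/-- `Λ` solves the grouping problem: it is feasible, and has the largest number of groups. -/
def IsOptimalGrouping {N M : ℕ} (B : Matrix (Fin N) (Fin M) ℕ) (Λ : SimilarityMatrix N) :
    Prop :=
  IsFeasible B Λ ∧ ∀ Λ' : SimilarityMatrix N, IsFeasible B Λ' → numGroups Λ' ≤ numGroups Λ

/-! ### Retrieval schemes -/

/-- A storage and retrieval scheme for `K` messages in `F ^ L` on `N` servers. The storage is
encoded from the messages and a random noise, the queries from the index of the wanted message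
and a random key of the user, and an answer is a deterministic function of the query and the
storage at the server. -/
structure Scheme (F : Type) (N K : ℕ) where
  /-- The message length. -/
  L : ℕ
  L_pos : 0 < L
  /-- The alphabet of the storage noise. -/
  Noise : Type
  [fintypeNoise : Fintype Noise]
  noiseLaw : PMF Noise
  /-- The alphabet of the private randomness of the user. -/
  Key : Type
  [fintypeKey : Fintype Key]
  keyLaw : PMF Key
  /-- The query alphabet. -/
  Query : Type
  [fintypeQuery : Fintype Query]
  storageLen : Fin N → ℕ
  answerLen : Fin N → ℕ
  encode : (n : Fin N) → (Fin K → Fin L → F) → Noise → (Fin (storageLen n) → F)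
  query : Fin K → Key → Fin N → Query
  answer : (n : Fin N) → Query → (Fin (storageLen n) → F) → (Fin (answerLen n) → F)

attribute [instance] Scheme.fintypeNoise Scheme.fintypeKey Scheme.fintypeQuery

namespace Scheme

variable {F : Type} {N K : ℕ}

/-- An outcome consists of the messages, the storage noise, the key of the user and the index
of the wanted message. -/
abbrev Outcome (σ : Scheme F N K) : Type :=
  (Fin K → Fin σ.L → F) × σ.Noise × σ.Key × Fin K

/-- The messages `W_1, …, W_K`. -/
def W (σ : Scheme F N K) (ω : σ.Outcome) : Fin K → Fin σ.L → F := ω.1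

/-- The index `Θ` of the wanted message. -/
def Θ (σ : Scheme F N K) (ω : σ.Outcome) : Fin K := ω.2.2.2

/-- The storage `S_n` at the server `n`. -/
def S (σ : Scheme F N K) (n : Fin N) (ω : σ.Outcome) : Fin (σ.storageLen n) → F :=
  σ.encode n ω.1 ω.2.1

/-- The query `Q_n^{[k]}` to the server `n` when the message `k` is wanted. -/
def Q (σ : Scheme F N K) (k : Fin K) (n : Fin N) (ω : σ.Outcome) : σ.Query :=
  σ.query k ω.2.2.1 n

/-- The answer `A_n^{[k]}` of the server `n` when the message `k` is wanted. -/
def A (σ : Scheme F N K) (k : Fin K) (n : Fin N) (ω : σ.Outcome) : Fin (σ.answerLen n) → F :=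
  σ.answer n (σ.Q k n ω) (σ.S n ω)

variable [Field F] [Fintype F] [NeZero K]

/-- The joint law: uniform messages, noise, key and a uniform index, all independent. -/
def law (σ : Scheme F N K) : PMF σ.Outcome :=
  (PMF.uniformOfFintype (Fin K → Fin σ.L → F)).bind fun w =>
    σ.noiseLaw.bind fun z =>
      σ.keyLaw.bind fun u =>
        (PMF.uniformOfFintype (Fin K)).map fun θ => (w, z, u, θ)

/-- The servers in `X` together store nothing about the messages: `I(W ; S_X) = 0`. -/
def SecureAgainst (σ : Scheme F N K) (X : Finset (Fin N)) : Prop :=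
  mutualInfo (Fintype.card F) σ.law σ.W (fun ω (n : X) => σ.S n ω) = 0

/-- The servers in `T` together learn nothing about the index of the wanted message from the
queries that they receive: `I(Θ ; Q_T^{[Θ]}) = 0`. -/
def PrivateAgainst (σ : Scheme F N K) (T : Finset (Fin N)) : Prop :=
  mutualInfo (Fintype.card F) σ.law σ.Θ (fun ω (n : T) => σ.Q (σ.Θ ω) n ω) = 0

/-- The user, who knows the queries, recovers the wanted message from the answers:
`H(W_k | A_{[N]}^{[k]}, Q_{[N]}^{[k]}) = 0` for all `k`. -/
def Decodable (σ : Scheme F N K) : Prop :=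
  ∀ k, condEntropy (Fintype.card F) σ.law (fun ω => σ.W ω k)
    (fun ω => ((fun n => σ.A k n ω), (fun n => σ.Q k n ω))) = 0

/-- The scheme is secure against every single server and every link in `𝒳`, private against every
single server and every colluding set in `𝒯`, and decodable. -/
structure IsAdmissible (σ : Scheme F N K) (𝒳 𝒯 : Finset (Finset (Fin N))) : Prop where
  secure_single : ∀ n, σ.SecureAgainst {n}
  secure_link : ∀ X ∈ 𝒳, σ.SecureAgainst X
  private_single : ∀ n, σ.PrivateAgainst {n}
  private_collusion : ∀ T ∈ 𝒯, σ.PrivateAgainst T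
  decodable : σ.Decodable

/-- The rate `L / ∑_n H(A_n^{[k]})`. -/
def rate (σ : Scheme F N K) (k : Fin K) : ℝ :=
  (σ.L : ℝ) / ∑ n, entropy (Fintype.card F) σ.law (σ.A k n)

end Scheme

/-- The rates that are achieved, whichever message is wanted, by some admissible scheme
(of any message length). -/
def achievableRates (F : Type) [Field F] [Fintype F] (N K : ℕ) [NeZero K]
    (𝒳 𝒯 : Finset (Finset (Fin N))) : Set ℝ :=
  {R | ∃ σ : Scheme F N K, σ.IsAdmissible 𝒳 𝒯 ∧ ∀ k, R ≤ σ.rate k}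

/-- `C` is the capacity: the supremum of the achievable rates. -/
def IsCapacity (F : Type) [Field F] [Fintype F] (N K : ℕ) [NeZero K]
    (𝒳 𝒯 : Finset (Finset (Fin N))) (C : ℝ) : Prop :=
  IsLUB (achievableRates F N K 𝒳 𝒯) C

/-- `C_PIR(g, K) = (1 + 1/g + ⋯ + 1/g^(K-1))⁻¹`. -/
def CPIR (g K : ℕ) : ℝ := (∑ i ∈ Finset.range K, (1 / (g : ℝ)) ^ i)⁻¹

/-- `η_{K,T}(X) = ∑_{i=1}^{K-1} (T / (N - |X|))^i`. -/
def etaT {N : ℕ} (K T : ℕ) (X : Finset (Fin N)) : ℝ :=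
  ∑ i ∈ Finset.Ico 1 K, ((T : ℝ) / ((N : ℝ) - (X.card : ℝ))) ^ i

/-- `η_K(X) = η_{K,1}(X)`. -/
def eta {N : ℕ} (K : ℕ) (X : Finset (Fin N)) : ℝ := etaT K 1 X

end

end AXPIR

/-!
Converse: fix a link `X`. Given the user's key and what the servers in `X` store, security makes
each message worth `L` fresh symbols, and privacy of the single servers makes the conditional
entropy of an answer independent of the wanted message. When the messages are revealed one at a
time, the answers outside `X` therefore keep at least the fraction `1 / |Xᶜ|` of their entropy as
the wanted message changes, so that `∑ n ∉ X, H(Aₙ) ≥ L * ∑ i < K, |Xᶜ|⁻ⁱ`. Averaging over the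
links, where each server is missed by at most `λ` of them, bounds the rate by `λ / M` times
`(∑ i < K, g⁻ⁱ)⁻¹`.

Achievability: the hypothesis on `λ / M` forces all groups to have the same size `s = M / λ`. The
servers of a group hold additive shares of what one server of the Tian–Sun–Chen scheme for `g`
servers stores; the answers of that scheme are additive in the storage, so the shares of the answer
add up to the answer and the download grows by the factor `s`. No link contains a whole group,
hence security, and the members of a group see the same query, hence privacy.
-/

namespace AXPIR

noncomputable section

/-! ### Gibbs' inequality -/

section Gibbs

open InformationTheory (klFun klFun_apply klFun_zero klFun_nonneg klFun_eq_zero_iff)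

theorem mul_log_sub_mul_log_eq_klFun {a b : ℝ} (h : b = 0 → a = 0) :
    a * Real.log a - a * Real.log b = b * klFun (a / b) + (a - b) := by
  rcases eq_or_ne a 0 with rfl | ha
  · simp [klFun_zero]
  · have hb : b ≠ 0 := mt h ha
    rw [klFun_apply, Real.log_div ha hb]
    field_simp
    ring

variable {α : Type*} [Fintype α] {a b : α → ℝ}

theorem sum_mul_log_le_sum_mul_log_self (ha : ∀ x, 0 ≤ a x) (hb : ∀ x, 0 ≤ b x)
    (h : ∀ x, b x = 0 → a x = 0) (hab : ∑ x, b x ≤ ∑ x, a x) :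
    ∑ x, a x * Real.log (b x) ≤ ∑ x, a x * Real.log (a x) := by
  have hkl : 0 ≤ ∑ x, b x * klFun (a x / b x) :=
    Finset.sum_nonneg fun x _ => mul_nonneg (hb x) (klFun_nonneg (div_nonneg (ha x) (hb x)))
  have hsum : ∑ x, (a x * Real.log (a x) - a x * Real.log (b x)) =
      ∑ x, (b x * klFun (a x / b x) + (a x - b x)) :=
    Finset.sum_congr rfl fun x _ => mul_log_sub_mul_log_eq_klFun (h x)
  simp only [Finset.sum_sub_distrib, Finset.sum_add_distrib] at hsum
  linarith

theorem eq_of_sum_mul_log_self_le (ha : ∀ x, 0 ≤ a x) (hb : ∀ x, 0 ≤ b x)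
    (h : ∀ x, b x = 0 → a x = 0) (hab : ∑ x, b x ≤ ∑ x, a x)
    (hle : ∑ x, a x * Real.log (a x) ≤ ∑ x, a x * Real.log (b x)) (x : α) : a x = b x := by
  have hkl : ∀ x ∈ Finset.univ, 0 ≤ b x * klFun (a x / b x) :=
    fun x _ => mul_nonneg (hb x) (klFun_nonneg (div_nonneg (ha x) (hb x)))
  have hsum : ∑ x, (a x * Real.log (a x) - a x * Real.log (b x)) =
      ∑ x, (b x * klFun (a x / b x) + (a x - b x)) :=
    Finset.sum_congr rfl fun x _ => mul_log_sub_mul_log_eq_klFun (h x)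
  simp only [Finset.sum_sub_distrib, Finset.sum_add_distrib] at hsum
  have hzero : ∑ x, b x * klFun (a x / b x) = 0 :=
    le_antisymm (by linarith) (Finset.sum_nonneg hkl)
  rcases mul_eq_zero.1 ((Finset.sum_eq_zero_iff_of_nonneg hkl).1 hzero x (Finset.mem_univ x))
    with hbx | hx
  · rw [hbx, h x hbx]
  · rw [klFun_eq_zero_iff (div_nonneg (ha x) (hb x))] at hx
    exact eq_of_div_eq_one hx

end Gibbs

/-! ### Entropies -/

variable {Ω α β γ δ : Type}

/-- The probability `P(X = x)`, as a real number. -/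
def prob (P : PMF Ω) (X : Ω → β) (x : β) : ℝ := ((P.map X) x).toReal

theorem prob_nonneg (P : PMF Ω) (X : Ω → β) (x : β) : 0 ≤ prob P X x := ENNReal.toReal_nonneg

open scoped Classical in
theorem prob_eq_sum [Fintype Ω] (P : PMF Ω) (X : Ω → β) (x : β) :
    prob P X x = ∑ ω, if X ω = x then (P ω).toReal else 0 := by
  rw [prob, PMF.map_apply, tsum_fintype, ENNReal.toReal_sum]
  · refine Finset.sum_congr rfl fun ω _ => ?_
    simp only [eq_comm (a := x), apply_ite ENNReal.toReal, ENNReal.toReal_zero]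
  · intro ω _
    split_ifs
    exacts [P.apply_ne_top ω, ENNReal.zero_ne_top]

theorem prob_mono [Finite Ω] (P : PMF Ω) {X : Ω → β} {Y : Ω → γ} {x : β} {y : γ}
    (h : ∀ ω, X ω = x → Y ω = y) : prob P X x ≤ prob P Y y := by
  cases nonempty_fintype Ω
  classical
  simp only [prob_eq_sum]
  refine Finset.sum_le_sum fun ω _ => ?_
  by_cases hx : X ω = x
  · rw [if_pos hx, if_pos (h ω hx)]
  · rw [if_neg hx]
    split_ifs
    exacts [ENNReal.toReal_nonneg, le_rfl]

theorem prob_pos [Finite Ω] (P : PMF Ω) (X : Ω → β) {ω : Ω} (hω : (P ω).toReal ≠ 0) :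
    0 < prob P X (X ω) := by
  have hid : prob P id ω = (P ω).toReal := by rw [prob, PMF.map_id]
  refine lt_of_lt_of_le ?_ (prob_mono P (X := id) (x := ω) fun ω' h => congrArg X h)
  exact hid ▸ lt_of_le_of_ne ENNReal.toReal_nonneg hω.symm

theorem sum_prob_mul [Fintype Ω] [Fintype β] (P : PMF Ω) (X : Ω → β) (f : β → ℝ) :
    ∑ x, prob P X x * f x = ∑ ω, (P ω).toReal * f (X ω) := by
  classical
  simp only [prob_eq_sum, Finset.sum_mul, ite_mul, zero_mul]
  rw [Finset.sum_comm]
  simp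

theorem sum_prob [Fintype β] (P : PMF Ω) (X : Ω → β) : ∑ x, prob P X x = 1 := by
  simp only [prob]
  rw [← ENNReal.toReal_sum fun x _ => (P.map X).apply_ne_top x,
    ← tsum_fintype (L := .unconditional β), PMF.tsum_coe, ENNReal.toReal_one]

theorem sum_prob_pair_left [Finite Ω] [Fintype β] (P : PMF Ω) (X : Ω → β) (Y : Ω → γ) (y : γ) :
    ∑ x, prob P (fun ω => (X ω, Y ω)) (x, y) = prob P Y y := by
  cases nonempty_fintype Ω
  classical
  simp only [prob_eq_sum, Prod.mk.injEq, ite_and]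
  rw [Finset.sum_comm]
  simp

theorem entropy_eq_sum [Fintype Ω] [Fintype β] (q : ℕ) (P : PMF Ω) (X : Ω → β) :
    entropy q P X = (-∑ ω, (P ω).toReal * Real.log (prob P X (X ω))) / Real.log q := by
  rw [← sum_prob_mul P X fun x => Real.log (prob P X x), ← Finset.sum_neg_distrib]
  simp only [entropy, Real.negMulLog, prob, neg_mul]

theorem entropy_le_of_factorsThrough [Finite Ω] [Fintype β] [Fintype γ] (q : ℕ) (P : PMF Ω)
    {X : Ω → β} {Y : Ω → γ} (h : Y.FactorsThrough X) : entropy q P Y ≤ entropy q P X := by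
  cases nonempty_fintype Ω
  rw [entropy_eq_sum, entropy_eq_sum]
  refine div_le_div_of_nonneg_right (neg_le_neg (Finset.sum_le_sum fun ω _ => ?_))
    (Real.log_natCast_nonneg q)
  rcases eq_or_ne (P ω).toReal 0 with hω | hω
  · simp [hω]
  · gcongr
    · exact prob_pos P X hω
    · exact prob_mono P fun ω' hX => h hX

theorem entropy_congr [Finite Ω] [Fintype β] [Fintype γ] (q : ℕ) (P : PMF Ω) {X : Ω → β}
    {Y : Ω → γ} (h : ∀ ω ω', X ω = X ω' ↔ Y ω = Y ω') : entropy q P X = entropy q P Y :=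
  le_antisymm (entropy_le_of_factorsThrough q P fun ω ω' => (h ω ω').2)
    (entropy_le_of_factorsThrough q P fun ω ω' => (h ω ω').1)

theorem entropy_nonneg [Fintype β] (q : ℕ) (P : PMF Ω) (X : Ω → β) : 0 ≤ entropy q P X :=
  div_nonneg (Finset.sum_nonneg fun x _ => Real.negMulLog_nonneg ENNReal.toReal_nonneg
    (ENNReal.toReal_le_of_le_ofReal zero_le_one (by simpa using (P.map X).coe_le_one x)))
    (Real.log_natCast_nonneg q)

theorem entropy_le_cross [Fintype β] (q : ℕ) (P : PMF Ω) (X : Ω → β) {r : β → ℝ}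
    (hr : ∀ x, 0 < r x) (hsum : ∑ x, r x ≤ 1) :
    entropy q P X ≤ (-∑ x, prob P X x * Real.log (r x)) / Real.log q := by
  have gibbs := sum_mul_log_le_sum_mul_log_self (prob_nonneg P X) (fun x => (hr x).le)
    (fun x hx => absurd hx (hr x).ne') (hsum.trans_eq (sum_prob P X).symm)
  refine div_le_div_of_nonneg_right ?_ (Real.log_natCast_nonneg q)
  simpa [Real.negMulLog, prob] using gibbs

theorem entropy_le_logb_card [Fintype β] (q : ℕ) (P : PMF Ω) (X : Ω → β) :
    entropy q P X ≤ Real.logb q (Fintype.card β) := by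
  have : Nonempty β := P.support_nonempty.to_type.map X
  have hcard : (0 : ℝ) < Fintype.card β := mod_cast Fintype.card_pos
  refine (entropy_le_cross q P X (r := fun _ => (Fintype.card β : ℝ)⁻¹)
    (fun _ => inv_pos.2 hcard) ?_).trans_eq ?_
  · simp [hcard.ne']
  · rw [← Finset.sum_mul, sum_prob, one_mul, Real.log_inv, neg_neg, Real.logb]

theorem entropy_of_map_eq_uniformOfFintype [Fintype β] [Nonempty β] (q : ℕ) {P : PMF Ω}
    {X : Ω → β} (h : P.map X = PMF.uniformOfFintype β) :
    entropy q P X = Real.logb q (Fintype.card β) := by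
  simp [entropy, h, Real.negMulLog, Real.logb]

/-- Compare the law of `X` with the mixture, in equal proportions, of the point mass at `x₀` and
the uniform law. -/
theorem entropy_le_one_add_mul_logb_card [Fintype β] {q : ℕ} (hq : 2 ≤ q) (P : PMF Ω) (X : Ω → β)
    (x₀ : β) :
    entropy q P X ≤ 1 + (1 - prob P X x₀) * Real.logb q (Fintype.card β) := by
  classical
  set c : ℝ := (Fintype.card β : ℝ)
  have hc : 0 < c := Nat.cast_pos.2 (Fintype.card_pos_iff.2 ⟨x₀⟩)
  have hlogq : Real.log 2 ≤ Real.log q := Real.log_le_log two_pos (mod_cast hq)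
  have hlogq₀ : 0 < Real.log q := (Real.log_pos one_lt_two).trans_le hlogq
  have hlog : ∀ x, -Real.log (((if x = x₀ then 1 else 0) + c⁻¹) / 2) ≤
      Real.log 2 + (Real.log c - if x = x₀ then Real.log c else 0) := by
    intro x
    rw [Real.log_div (by split_ifs <;> positivity) two_ne_zero]
    split_ifs
    · have : 0 ≤ Real.log (1 + c⁻¹) := Real.log_nonneg (by simp [hc.le])
      linarith
    · rw [zero_add, Real.log_inv]
      linarith
  have hcross := entropy_le_cross q P X (r := fun x => ((if x = x₀ then 1 else 0) + c⁻¹) / 2)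
    (fun x => by split_ifs <;> positivity)
    (by rw [← Finset.sum_div, Finset.sum_add_distrib]; simp [c, hc.ne'])
  have hsum : -∑ x, prob P X x * Real.log (((if x = x₀ then 1 else 0) + c⁻¹) / 2) ≤
      Real.log 2 + (1 - prob P X x₀) * Real.log c :=
    calc _ = ∑ x, prob P X x * -Real.log (((if x = x₀ then 1 else 0) + c⁻¹) / 2) := by
            simp only [mul_neg, Finset.sum_neg_distrib]
      _ ≤ ∑ x, prob P X x * (Real.log 2 + (Real.log c - if x = x₀ then Real.log c else 0)) :=
            Finset.sum_le_sum fun x _ => mul_le_mul_of_nonneg_left (hlog x) (prob_nonneg P X x)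
      _ = Real.log 2 + (1 - prob P X x₀) * Real.log c := by
            simp only [mul_add, mul_sub, Finset.sum_add_distrib, Finset.sum_sub_distrib,
              ← Finset.sum_mul, sum_prob, mul_ite, mul_zero, Finset.sum_ite_eq', Finset.mem_univ,
              if_true]
            ring
  refine hcross.trans ((div_le_div_of_nonneg_right hsum hlogq₀.le).trans ?_)
  rw [add_div, mul_div_assoc, Real.logb]
  gcongr
  exact div_le_one_of_le₀ hlogq hlogq₀.le

theorem condEntropy_nonneg [Finite Ω] [Fintype β] [Fintype γ] (q : ℕ) (P : PMF Ω) (X : Ω → β)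
    (Y : Ω → γ) : 0 ≤ condEntropy q P X Y :=
  sub_nonneg.2 (entropy_le_of_factorsThrough q P fun _ _ h => congrArg Prod.snd h)

theorem condEntropy_eq_zero_of_factorsThrough [Finite Ω] [Fintype β] [Fintype γ] (q : ℕ)
    (P : PMF Ω) {X : Ω → β} {Y : Ω → γ} (h : X.FactorsThrough Y) : condEntropy q P X Y = 0 :=
  sub_eq_zero.2 (entropy_congr q P fun _ _ => by
    simpa only [Prod.mk.injEq, and_iff_right_iff_imp] using @h _ _)

theorem condEntropy_le_of_factorsThrough_left [Finite Ω] [Fintype β] [Fintype γ] [Fintype δ]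
    (q : ℕ) (P : PMF Ω) {X : Ω → β} {Y : Ω → γ} (Z : Ω → δ) (h : Y.FactorsThrough X) :
    condEntropy q P Y Z ≤ condEntropy q P X Z := by
  refine sub_le_sub_right (entropy_le_of_factorsThrough q P fun ω ω' hXZ => ?_) _
  obtain ⟨hX, hZ⟩ := Prod.ext_iff.1 hXZ
  exact Prod.ext (h hX) hZ

theorem condEntropy_pair [Finite Ω] [Fintype β] [Fintype γ] [Fintype δ] (q : ℕ) (P : PMF Ω)
    (X : Ω → β) (Y : Ω → γ) (Z : Ω → δ) :
    condEntropy q P (fun ω => (X ω, Y ω)) Z =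
      condEntropy q P Y Z + condEntropy q P X (fun ω => (Y ω, Z ω)) := by
  have hassoc : entropy q P (fun ω => ((X ω, Y ω), Z ω)) =
      entropy q P (fun ω => (X ω, (Y ω, Z ω))) :=
    entropy_congr q P fun _ _ => by simp only [Prod.mk.injEq, and_assoc]
  simp only [condEntropy, hassoc]
  ring

/-- Gibbs' inequality for the law of `(X, Y, Z)` against `P(X, Z) P(Y, Z) / P(Z)`. -/
theorem condEntropy_pair_le [Finite Ω] [Fintype β] [Fintype γ] [Fintype δ] (q : ℕ) (P : PMF Ω)
    (X : Ω → β) (Y : Ω → γ) (Z : Ω → δ) :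
    condEntropy q P X (fun ω => (Y ω, Z ω)) ≤ condEntropy q P X Z := by
  cases nonempty_fintype Ω
  set pXYZ := prob P fun ω => (X ω, (Y ω, Z ω))
  set pXZ := prob P fun ω => (X ω, Z ω)
  set pYZ := prob P fun ω => (Y ω, Z ω)
  set pZ := prob P Z
  let r : β × γ × δ → ℝ := fun x => pXZ (x.1, x.2.2) * pYZ x.2 / pZ x.2.2
  have hr : ∀ x, 0 ≤ r x := fun x =>
    div_nonneg (mul_nonneg (prob_nonneg ..) (prob_nonneg ..)) (prob_nonneg ..)
  have hpos : ∀ x, pXYZ x ≠ 0 → 0 < pXZ (x.1, x.2.2) ∧ 0 < pYZ x.2 ∧ 0 < pZ x.2.2 := by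
    intro x hx
    have hx : 0 < pXYZ x := lt_of_le_of_ne (prob_nonneg ..) hx.symm
    exact ⟨hx.trans_le (prob_mono P (by rintro ω rfl; rfl)),
      hx.trans_le (prob_mono P (by rintro ω rfl; rfl)),
      hx.trans_le (prob_mono P (by rintro ω rfl; rfl))⟩
  have habs : ∀ x, r x = 0 → pXYZ x = 0 := by
    refine fun x => not_imp_not.1 fun hx => ?_
    obtain ⟨hXZ, hYZ, hZ⟩ := hpos x hx
    exact (div_pos (mul_pos hXZ hYZ) hZ).ne'
  have hmass : ∑ x, r x ≤ ∑ x, pXYZ x := by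
    rw [sum_prob, Fintype.sum_prod_type_right, ← sum_prob P fun ω => (Y ω, Z ω)]
    refine Finset.sum_le_sum fun y _ => ?_
    calc ∑ x, pXZ (x, y.2) * pYZ y / pZ y.2 = pZ y.2 / pZ y.2 * pYZ y := by
          rw [← Finset.sum_div, ← Finset.sum_mul, sum_prob_pair_left, div_mul_eq_mul_div]
      _ ≤ pYZ y := mul_le_of_le_one_left (prob_nonneg ..) (div_self_le_one _)
  have gibbs := sum_mul_log_le_sum_mul_log_self (fun x => prob_nonneg P _ x) hr habs hmass
  have hlog : ∑ x, pXYZ x * Real.log (r x) = ∑ x, pXYZ x * Real.log (pXZ (x.1, x.2.2)) +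
      ∑ x, pXYZ x * Real.log (pYZ x.2) - ∑ x, pXYZ x * Real.log (pZ x.2.2) := by
    rw [← Finset.sum_add_distrib, ← Finset.sum_sub_distrib]
    refine Finset.sum_congr rfl fun x _ => ?_
    rcases eq_or_ne (pXYZ x) 0 with hx | hx
    · simp [hx]
    · obtain ⟨hXZ, hYZ, hZ⟩ := hpos x hx
      simp only [r]
      rw [Real.log_div (mul_pos hXZ hYZ).ne' hZ.ne', Real.log_mul hXZ.ne' hYZ.ne']
      ring
  rw [hlog] at gibbs
  simp only [pXYZ, sum_prob_mul] at gibbs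
  simp only [condEntropy, entropy_eq_sum, ← sub_div]
  exact div_le_div_of_nonneg_right (by linarith) (Real.log_natCast_nonneg q)

theorem condEntropy_le_of_factorsThrough_right [Finite Ω] [Fintype β] [Fintype γ] [Fintype δ]
    (q : ℕ) (P : PMF Ω) (X : Ω → β) {Y : Ω → γ} {Z : Ω → δ} (h : Z.FactorsThrough Y) :
    condEntropy q P X Y ≤ condEntropy q P X Z := by
  have hY : entropy q P (fun ω => (Y ω, Z ω)) = entropy q P Y :=
    entropy_congr q P fun ω ω' => by
      simpa only [Prod.mk.injEq, and_iff_left_iff_imp] using @h ω ω'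
  have hXY : entropy q P (fun ω => (X ω, (Y ω, Z ω))) = entropy q P (fun ω => (X ω, Y ω)) :=
    entropy_congr q P fun ω ω' => by
      simpa only [Prod.mk.injEq, ← and_assoc, and_iff_left_iff_imp] using
        fun hXY => @h ω ω' hXY.2
  simpa only [condEntropy, hXY, hY] using condEntropy_pair_le q P X Y Z

theorem condEntropy_le_entropy [Finite Ω] [Fintype β] [Fintype γ] (q : ℕ) (P : PMF Ω)
    (X : Ω → β) (Y : Ω → γ) : condEntropy q P X Y ≤ entropy q P X := by
  have hXU : entropy q P (fun ω => (X ω, ())) = entropy q P X :=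
    entropy_congr q P fun _ _ => by simp
  calc condEntropy q P X Y ≤ condEntropy q P X (fun _ => ()) :=
        condEntropy_le_of_factorsThrough_right q P X fun _ _ _ => rfl
    _ ≤ entropy q P X := by
        rw [condEntropy, hXU]
        exact sub_le_self _ (entropy_nonneg ..)

theorem condEntropy_pi_le_sum [Finite Ω] [Fintype γ] {ι : Type} [DecidableEq ι] {β : ι → Type}
    [∀ i, Fintype (β i)] (q : ℕ) (P : PMF Ω) (X : ∀ i, Ω → β i) (Y : Ω → γ) (T : Finset ι) :
    condEntropy q P (fun ω (i : T) => X i ω) Y ≤ ∑ i ∈ T, condEntropy q P (X i) Y := by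
  induction T using Finset.induction_on with
  | empty =>
    rw [Finset.sum_empty]
    exact (condEntropy_eq_zero_of_factorsThrough q P fun _ _ _ => Subsingleton.elim _ _).le
  | insert i T hi ih =>
    calc condEntropy q P (fun ω (j : ↥(insert i T)) => X j ω) Y
        ≤ condEntropy q P (fun ω => (X i ω, fun j : T => X j ω)) Y :=
          condEntropy_le_of_factorsThrough_left q P Y fun ω ω' h => by
            obtain ⟨hi, hT⟩ := Prod.ext_iff.1 h
            funext ⟨j, hj⟩
            rcases Finset.mem_insert.1 hj with rfl | hj
            exacts [hi, congrFun hT ⟨j, hj⟩]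
      _ = condEntropy q P (fun ω (j : T) => X j ω) Y +
            condEntropy q P (X i) (fun ω => ((fun j : T => X j ω), Y ω)) := condEntropy_pair ..
      _ ≤ ∑ j ∈ T, condEntropy q P (X j) Y + condEntropy q P (X i) Y :=
          add_le_add ih (condEntropy_pair_le ..)
      _ = ∑ j ∈ insert i T, condEntropy q P (X j) Y := by rw [Finset.sum_insert hi, add_comm]

theorem mutualInfo_eq_zero_of_prob_pair [Finite Ω] [Fintype β] [Fintype γ] (q : ℕ) {P : PMF Ω}
    {X : Ω → β} {Y : Ω → γ}
    (h : ∀ x y, prob P (fun ω => (X ω, Y ω)) (x, y) = prob P X x * prob P Y y) :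
    mutualInfo q P X Y = 0 := by
  cases nonempty_fintype Ω
  have hlog : ∀ ω, (P ω).toReal * Real.log (prob P (fun ω => (X ω, Y ω)) (X ω, Y ω)) =
      (P ω).toReal * Real.log (prob P X (X ω)) + (P ω).toReal * Real.log (prob P Y (Y ω)) := by
    intro ω
    rcases eq_or_ne (P ω).toReal 0 with hω | hω
    · simp [hω]
    · rw [h, Real.log_mul (prob_pos P X hω).ne' (prob_pos P Y hω).ne', mul_add]
  simp only [mutualInfo, entropy_eq_sum, hlog, Finset.sum_add_distrib]
  ring

theorem prob_pair_of_mutualInfo_eq_zero [Finite Ω] [Fintype β] [Fintype γ] {q : ℕ} (hq : 1 < q)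
    {P : PMF Ω} {X : Ω → β} {Y : Ω → γ} (h : mutualInfo q P X Y = 0) (x : β) (y : γ) :
    prob P (fun ω => (X ω, Y ω)) (x, y) = prob P X x * prob P Y y := by
  cases nonempty_fintype Ω
  have hlogq : Real.log q ≠ 0 := (Real.log_pos (mod_cast hq)).ne'
  have hpos : ∀ z : β × γ, prob P (fun ω => (X ω, Y ω)) z ≠ 0 →
      0 < prob P X z.1 ∧ 0 < prob P Y z.2 := by
    intro z hz
    have hz : 0 < prob P (fun ω => (X ω, Y ω)) z := lt_of_le_of_ne (prob_nonneg ..) hz.symm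
    exact ⟨hz.trans_le (prob_mono P (by rintro ω rfl; rfl)),
      hz.trans_le (prob_mono P (by rintro ω rfl; rfl))⟩
  refine eq_of_sum_mul_log_self_le (a := prob P fun ω => (X ω, Y ω))
    (b := fun z => prob P X z.1 * prob P Y z.2) (fun z => prob_nonneg ..)
    (fun z => mul_nonneg (prob_nonneg ..) (prob_nonneg ..)) (fun z => not_imp_not.1 fun hz => ?_)
    ?_ ?_ (x, y)
  · exact (mul_pos (hpos z hz).1 (hpos z hz).2).ne'
  · rw [sum_prob, Fintype.sum_prod_type]
    simp only [← Finset.mul_sum, sum_prob, mul_one, le_refl]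
  · have hlog : ∀ z, prob P (fun ω => (X ω, Y ω)) z * Real.log (prob P X z.1 * prob P Y z.2) =
        prob P (fun ω => (X ω, Y ω)) z * Real.log (prob P X z.1) +
          prob P (fun ω => (X ω, Y ω)) z * Real.log (prob P Y z.2) := by
      intro z
      rcases eq_or_ne (prob P (fun ω => (X ω, Y ω)) z) 0 with hz | hz
      · simp [hz]
      · rw [Real.log_mul (hpos z hz).1.ne' (hpos z hz).2.ne', mul_add]
    simp only [hlog, Finset.sum_add_distrib, sum_prob_mul]
    simp only [mutualInfo, entropy_eq_sum, ← add_div, ← sub_div, div_eq_zero_iff, hlogq,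
      or_false] at h
    linarith

/-! ### Conditional laws -/

/-- The distributions `κ x` form a conditional law of `Y` given `X = x`. -/
def IsCondLaw (P : PMF Ω) (X : Ω → β) (Y : Ω → γ) (κ : β → PMF γ) : Prop :=
  P.map (fun ω => (X ω, Y ω)) = (P.map X).bind fun x => (κ x).map (Prod.mk x)

namespace IsCondLaw

variable {P : PMF Ω} {X : Ω → β} {Y : Ω → γ} {κ : β → PMF γ}

theorem comp (h : IsCondLaw P X Y κ) (f : β → γ → δ) :
    IsCondLaw P X (fun ω => f (X ω) (Y ω)) fun x => (κ x).map (f x) :=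
  calc P.map (fun ω => (X ω, f (X ω) (Y ω)))
      = (P.map fun ω => (X ω, Y ω)).map fun z => (z.1, f z.1 z.2) := by
        rw [PMF.map_comp, Function.comp_def]
    _ = (P.map X).bind fun x => ((κ x).map (f x)).map (Prod.mk x) := by
        rw [h, PMF.map_bind]
        simp only [PMF.map_comp, Function.comp_def]

theorem prob_pair (h : IsCondLaw P X Y κ) (x : β) (y : γ) :
    prob P (fun ω => (X ω, Y ω)) (x, y) = prob P X x * (κ x y).toReal := by
  classical
  have hκ : ∀ x', (κ x').map (Prod.mk x') (x, y) = if x' = x then κ x y else 0 := by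
    intro x'
    rw [PMF.map_apply]
    split_ifs with hx
    · subst hx
      simp
    · simp [Ne.symm hx]
  rw [prob, h, PMF.bind_apply, prob, ← ENNReal.toReal_mul]
  simp only [hκ, mul_ite, mul_zero, tsum_ite_eq]

theorem map_snd (h : IsCondLaw P X Y κ) : P.map Y = (P.map X).bind κ :=
  calc P.map Y = (P.map fun ω => (X ω, Y ω)).map Prod.snd := by
        rw [PMF.map_comp, Function.comp_def]
    _ = (P.map X).bind κ := by
        rw [h]
        simp only [PMF.map, PMF.bind_bind, PMF.pure_bind, Function.comp_apply, PMF.bind_pure]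

theorem entropy_pair [Fintype β] [Fintype γ] (h : IsCondLaw P X Y κ) (q : ℕ) :
    entropy q P (fun ω => (X ω, Y ω)) =
      entropy q P X + ∑ x, prob P X x * entropy q (κ x) id := by
  have hκ : ∀ x, ∑ y, (κ x y).toReal = 1 := fun x => by
    simpa only [prob, PMF.map_id] using sum_prob (κ x) id
  have hterm : ∀ x y, Real.negMulLog (P.map (fun ω => (X ω, Y ω)) (x, y)).toReal =
      (κ x y).toReal * Real.negMulLog (prob P X x) +
        prob P X x * Real.negMulLog (κ x y).toReal := fun x y => by
    rw [← prob, h.prob_pair, Real.negMulLog_mul]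
  simp only [entropy, Fintype.sum_prod_type, hterm, Finset.sum_add_distrib, ← Finset.sum_mul,
    ← Finset.mul_sum, hκ, one_mul, add_div, Finset.sum_div, mul_div_assoc, PMF.map_id, prob]

theorem mutualInfo_eq_zero_of_forall_eq [Finite Ω] [Fintype β] [Fintype γ] {ν : PMF γ}
    (h : IsCondLaw P X Y fun _ => ν) (q : ℕ) : mutualInfo q P X Y = 0 :=
  mutualInfo_eq_zero_of_prob_pair q fun x y => by
    rw [h.prob_pair, prob, prob, h.map_snd, PMF.bind_const]

theorem mutualInfo_eq_zero_iff [Finite Ω] [Fintype β] [Fintype γ] (h : IsCondLaw P X Y κ)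
    {q : ℕ} (hq : 1 < q) (hX : ∀ x, P.map X x ≠ 0) :
    mutualInfo q P X Y = 0 ↔ ∀ x x', κ x = κ x' := by
  constructor
  · intro h₀
    have hκ : ∀ x y, (κ x y).toReal = prob P Y y := fun x y =>
      mul_left_cancel₀ (ENNReal.toReal_ne_zero.2 ⟨hX x, (P.map X).apply_ne_top x⟩)
        ((h.prob_pair x y).symm.trans (prob_pair_of_mutualInfo_eq_zero hq h₀ x y))
    intro x x'
    ext y
    rw [← ENNReal.toReal_eq_toReal_iff' ((κ x).apply_ne_top y) ((κ x').apply_ne_top y), hκ, hκ]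
  · intro hκ
    obtain ⟨x, -⟩ := (P.map X).support_nonempty
    rw [show κ = fun _ => κ x from funext fun x' => hκ x' x] at h
    exact h.mutualInfo_eq_zero_of_forall_eq q

end IsCondLaw

theorem map_eq_of_map_pair_eq_bind {P : PMF Ω} {X : Ω → β} {Y : Ω → γ} {μ : PMF β}
    {κ : β → PMF γ} (h : P.map (fun ω => (X ω, Y ω)) = μ.bind fun x => (κ x).map (Prod.mk x)) :
    P.map X = μ :=
  calc P.map X = (P.map fun ω => (X ω, Y ω)).map Prod.fst := by
        rw [PMF.map_comp, Function.comp_def]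
    _ = μ := by
        rw [h]
        simp only [PMF.map, PMF.bind_bind, PMF.pure_bind, Function.comp_apply, PMF.bind_const,
          PMF.bind_pure]

theorem isCondLaw_of_map_pair_eq_bind {P : PMF Ω} {X : Ω → β} {Y : Ω → γ} {μ : PMF β}
    {κ : β → PMF γ} (h : P.map (fun ω => (X ω, Y ω)) = μ.bind fun x => (κ x).map (Prod.mk x)) :
    IsCondLaw P X Y κ := by
  rw [IsCondLaw, map_eq_of_map_pair_eq_bind h, h]

namespace Scheme

variable {F : Type} {N K : ℕ} [Field F] [Fintype F] [NeZero K] (σ : Scheme F N K)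

/-- The private randomness of the user. -/
def U (ω : σ.Outcome) : σ.Key := ω.2.2.1

/-- The joint law of the messages and the storage noise, which determine the storage. -/
def dataLaw : PMF ((Fin K → Fin σ.L → F) × σ.Noise) :=
  (PMF.uniformOfFintype _).bind fun w => σ.noiseLaw.map (Prod.mk w)

theorem law_map_messages_noise : σ.law.map (fun ω => (σ.W ω, ω.2.1)) = σ.dataLaw := by
  simp only [law, dataLaw, W, PMF.map, PMF.bind_bind, PMF.pure_bind, Function.comp_def,
    PMF.bind_const]

theorem law_map_index_key : σ.law.map (fun ω => (σ.Θ ω, σ.U ω)) =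
    (PMF.uniformOfFintype (Fin K)).bind fun k => σ.keyLaw.map (Prod.mk k) := by
  simp only [law, Θ, U, PMF.map, PMF.bind_bind, PMF.pure_bind, Function.comp_def, PMF.bind_const]
  exact PMF.bind_comm ..

theorem law_map_key_data : σ.law.map (fun ω => (σ.U ω, (σ.W ω, ω.2.1))) =
    σ.keyLaw.bind fun u => σ.dataLaw.map (Prod.mk u) := by
  simp only [law, dataLaw, W, U, PMF.map, PMF.bind_bind, PMF.pure_bind, Function.comp_def,
    PMF.bind_const]
  rw [PMF.bind_comm σ.keyLaw]
  simp only [PMF.bind_comm σ.keyLaw]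

theorem secureAgainst_iff (X : Finset (Fin N)) :
    σ.SecureAgainst X ↔ ∀ w w', σ.noiseLaw.map (fun z (n : X) => σ.encode n w z) =
      σ.noiseLaw.map (fun z (n : X) => σ.encode n w' z) :=
  ((isCondLaw_of_map_pair_eq_bind σ.law_map_messages_noise).comp
    fun w z (n : X) => σ.encode n w z).mutualInfo_eq_zero_iff Fintype.one_lt_card fun w => by
      rw [map_eq_of_map_pair_eq_bind σ.law_map_messages_noise]
      simp

theorem privateAgainst_iff (T : Finset (Fin N)) :
    σ.PrivateAgainst T ↔ ∀ k k', σ.keyLaw.map (fun u (n : T) => σ.query k u n) =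
      σ.keyLaw.map (fun u (n : T) => σ.query k' u n) :=
  ((isCondLaw_of_map_pair_eq_bind σ.law_map_index_key).comp
    fun k u (n : T) => σ.query k u n).mutualInfo_eq_zero_iff Fintype.one_lt_card fun k => by
      rw [map_eq_of_map_pair_eq_bind σ.law_map_index_key]
      simp

end Scheme

/-! ### The converse -/

theorem logb_card_vec (F : Type) [Field F] [Fintype F] (ι : Type) [Fintype ι] [DecidableEq ι] :
    Real.logb (Fintype.card F) (Fintype.card (ι → F)) = Fintype.card ι := by
  rw [Fintype.card_fun, Nat.cast_pow, Real.logb_pow,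
    Real.logb_self_eq_one (mod_cast Fintype.one_lt_card), mul_one]

theorem logb_card_vecs (F : Type) [Field F] [Fintype F] (ι : Type) [Fintype ι] [DecidableEq ι]
    (d : ℕ) : Real.logb (Fintype.card F) (Fintype.card (ι → Fin d → F)) = Fintype.card ι * d := by
  rw [Fintype.card_fun, Nat.cast_pow, Real.logb_pow, logb_card_vec, Fintype.card_fin]

namespace Scheme

variable {F : Type} {N K : ℕ} [Field F] [Fintype F] [NeZero K] (σ : Scheme F N K)

theorem entropy_W : entropy (Fintype.card F) σ.law σ.W = K * σ.L := by
  have hW : σ.law.map σ.W = PMF.uniformOfFintype _ :=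
    map_eq_of_map_pair_eq_bind σ.law_map_messages_noise
  rw [entropy_of_map_eq_uniformOfFintype _ hW, logb_card_vecs, Fintype.card_fin]

theorem entropy_data_key {β : Type} [Fintype β] (q : ℕ)
    (f : (Fin K → Fin σ.L → F) → σ.Noise → β) :
    entropy q σ.law (fun ω => (f (σ.W ω) ω.2.1, σ.U ω)) =
      entropy q σ.law (fun ω => f (σ.W ω) ω.2.1) + entropy q σ.law σ.U := by
  have h := ((isCondLaw_of_map_pair_eq_bind σ.law_map_key_data).comp
    fun _ d => f d.1 d.2).mutualInfo_eq_zero_of_forall_eq q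
  have hswap : entropy q σ.law (fun ω => (σ.U ω, f (σ.W ω) ω.2.1)) =
      entropy q σ.law (fun ω => (f (σ.W ω) ω.2.1, σ.U ω)) :=
    entropy_congr q _ fun _ _ => by simp only [Prod.mk.injEq, and_comm]
  rw [mutualInfo, hswap] at h
  linarith

variable {σ}

theorem PrivateAgainst.map_query_eq {n : Fin N} (h : σ.PrivateAgainst {n}) (k k' : Fin K) :
    σ.keyLaw.map (fun u => σ.query k u n) = σ.keyLaw.map (fun u => σ.query k' u n) := by
  have hn := congrArg (PMF.map fun s : ({n} : Finset (Fin N)) → σ.Query =>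
    s ⟨n, Finset.mem_singleton_self n⟩) ((σ.privateAgainst_iff {n}).1 h k k')
  simpa only [PMF.map_comp, Function.comp_def] using hn

/-- Given the key, the answer is a function of the query and the storage, and the law of the
query does not depend on the wanted message. -/
theorem PrivateAgainst.entropy_key_answer_data {n : Fin N} (h : σ.PrivateAgainst {n})
    {β : Type} [Fintype β] (q : ℕ) (f : (Fin K → Fin σ.L → F) → σ.Noise → β) (k k' : Fin K) :
    entropy q σ.law (fun ω => (σ.U ω, (σ.A k n ω, f (σ.W ω) ω.2.1))) =
      entropy q σ.law (fun ω => (σ.U ω, (σ.A k' n ω, f (σ.W ω) ω.2.1))) := by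
  let Φ : σ.Query → ℝ := fun s =>
    entropy q (σ.dataLaw.map fun d => (σ.answer n s (σ.encode n d.1 d.2), f d.1 d.2)) id
  have hΦ : ∀ k, entropy q σ.law (fun ω => (σ.U ω, (σ.A k n ω, f (σ.W ω) ω.2.1))) =
      entropy q σ.law σ.U + ∑ s, prob σ.keyLaw (fun u => σ.query k u n) s * Φ s := by
    intro k
    have hU : σ.law.map σ.U = σ.keyLaw := map_eq_of_map_pair_eq_bind σ.law_map_key_data
    have hlaw := (isCondLaw_of_map_pair_eq_bind σ.law_map_key_data).comp fun u d =>
      (σ.answer n (σ.query k u n) (σ.encode n d.1 d.2), f d.1 d.2)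
    rw [sum_prob_mul, ← hU]
    exact hlaw.entropy_pair q
  simp only [hΦ, prob, h.map_query_eq k k']

variable (σ)

/-- What the converse reveals besides the answers: the storage of the servers in `X`, the
messages in `J`, and the key. -/
def side (X : Finset (Fin N)) (J : Finset (Fin K)) (ω : σ.Outcome) :
    (((n : X) → Fin (σ.storageLen n) → F) × (J → Fin σ.L → F)) × σ.Key :=
  ((fun n => σ.S n ω, fun k => σ.W ω k), σ.U ω)

/-- The conditional entropy, given the side information, of the answers outside `X` when the
message `k` is wanted. -/
def residual (X : Finset (Fin N)) (J : Finset (Fin K)) (k : Fin K) : ℝ :=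
  condEntropy (Fintype.card F) σ.law (fun ω (n : ↥Xᶜ) => σ.A k n ω) (σ.side X J)

theorem residual_nonneg (X : Finset (Fin N)) (J : Finset (Fin K)) (k : Fin K) :
    0 ≤ σ.residual X J k :=
  condEntropy_nonneg ..

theorem condEntropy_answer_side_eq {n : Fin N} (h : σ.PrivateAgainst {n}) (X : Finset (Fin N))
    (J : Finset (Fin K)) (q : ℕ) (k k' : Fin K) :
    condEntropy q σ.law (σ.A k n) (σ.side X J) = condEntropy q σ.law (σ.A k' n) (σ.side X J) := by
  have hside : ∀ k, entropy q σ.law (fun ω => (σ.A k n ω, σ.side X J ω)) =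
      entropy q σ.law (fun ω => (σ.U ω, (σ.A k n ω, (σ.side X J ω).1))) := fun k =>
    entropy_congr q _ fun _ _ => by
      simp only [side, Prod.mk.injEq]
      tauto
  have hkey := h.entropy_key_answer_data q
    (fun w z => ((fun n : X => σ.encode n w z), (fun j : J => w j))) k k'
  rw [condEntropy, condEntropy, hside, hside]
  exact congrArg (· - _) hkey

theorem SecureAgainst.entropy_messages_storage_key {X : Finset (Fin N)}
    (hX : σ.SecureAgainst X) :
    entropy (Fintype.card F) σ.law (fun ω => (σ.W ω, ((fun n : X => σ.S n ω), σ.U ω))) =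
      K * σ.L + entropy (Fintype.card F) σ.law (fun ω => ((fun n : X => σ.S n ω), σ.U ω)) := by
  set q := Fintype.card F
  have hSU : entropy q σ.law (fun ω => ((fun n : X => σ.S n ω), σ.U ω)) =
      entropy q σ.law (fun ω (n : X) => σ.S n ω) + entropy q σ.law σ.U :=
    σ.entropy_data_key q fun w z (n : X) => σ.encode n w z
  have hWSU : entropy q σ.law (fun ω => ((σ.W ω, fun n : X => σ.S n ω), σ.U ω)) =
      entropy q σ.law (fun ω => (σ.W ω, fun n : X => σ.S n ω)) + entropy q σ.law σ.U :=
    σ.entropy_data_key q fun w z => (w, fun n : X => σ.encode n w z)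
  have hassoc : entropy q σ.law (fun ω => (σ.W ω, ((fun n : X => σ.S n ω), σ.U ω))) =
      entropy q σ.law (fun ω => ((σ.W ω, fun n : X => σ.S n ω), σ.U ω)) :=
    entropy_congr q _ fun _ _ => by simp only [Prod.mk.injEq, and_assoc]
  have hsecure : mutualInfo q σ.law σ.W (fun ω (n : X) => σ.S n ω) = 0 := hX
  rw [mutualInfo, entropy_W] at hsecure
  rw [hassoc, hWSU, hSU]
  linarith

theorem SecureAgainst.le_condEntropy_message {X : Finset (Fin N)} (hX : σ.SecureAgainst X)
    {J : Finset (Fin K)} {k : Fin K} (hk : k ∉ J) :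
    (σ.L : ℝ) ≤ condEntropy (Fintype.card F) σ.law (fun ω => σ.W ω k) (σ.side X J) := by
  set q := Fintype.card F
  let others : σ.Outcome → ↥({k}ᶜ : Finset (Fin K)) → Fin σ.L → F := fun ω j => σ.W ω j
  let view : σ.Outcome → ((n : X) → Fin (σ.storageLen n) → F) × σ.Key :=
    fun ω => ((fun n => σ.S n ω), σ.U ω)
  have hall : entropy q σ.law (fun ω => (σ.W ω, view ω)) = K * σ.L + entropy q σ.law view :=
    hX.entropy_messages_storage_key
  have hothers : entropy q σ.law others ≤ (K - 1) * σ.L := by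
    refine (entropy_le_logb_card ..).trans_eq ?_
    rw [logb_card_vecs, Fintype.card_coe, Finset.card_compl, Finset.card_singleton,
      Fintype.card_fin, Nat.cast_pred (NeZero.pos K)]
  have hpair : entropy q σ.law (fun ω => (others ω, view ω)) ≤
      entropy q σ.law others + entropy q σ.law view :=
    sub_le_iff_le_add.1 (condEntropy_le_entropy ..)
  have hsplit : entropy q σ.law (fun ω => (σ.W ω, view ω)) ≤
      entropy q σ.law (fun ω => (σ.W ω k, (others ω, view ω))) :=
    entropy_le_of_factorsThrough q _ fun ω ω' h => by
      obtain ⟨hWk, hrest⟩ := Prod.ext_iff.1 h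
      obtain ⟨hWj, hview⟩ := Prod.ext_iff.1 hrest
      refine Prod.ext (funext fun j => ?_) hview
      rcases eq_or_ne j k with rfl | hj
      exacts [hWk, congrFun hWj ⟨j, by simpa using hj⟩]
  calc (σ.L : ℝ) ≤ condEntropy q σ.law (fun ω => σ.W ω k) (fun ω => (others ω, view ω)) := by
        rw [condEntropy]
        linarith
    _ ≤ condEntropy q σ.law (fun ω => σ.W ω k) (σ.side X J) :=
        condEntropy_le_of_factorsThrough_right q _ _ fun ω ω' h => by
          obtain ⟨hWj, hview⟩ := Prod.ext_iff.1 h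
          obtain ⟨hS, hU⟩ := Prod.ext_iff.1 hview
          refine Prod.ext (Prod.ext hS (funext fun j => ?_)) hU
          exact congrFun hWj ⟨j, by simpa using ne_of_mem_of_not_mem j.2 hk⟩

theorem Decodable.condEntropy_message_eq_zero (h : σ.Decodable) (X : Finset (Fin N))
    (J : Finset (Fin K)) (k : Fin K) :
    condEntropy (Fintype.card F) σ.law (fun ω => σ.W ω k)
      (fun ω => ((fun n : ↥Xᶜ => σ.A k n ω), σ.side X J ω)) = 0 := by
  refine le_antisymm (le_trans ?_ (h k).le) (condEntropy_nonneg ..)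
  refine condEntropy_le_of_factorsThrough_right _ _ _ fun ω ω' h => ?_
  simp only [side, Prod.mk.injEq] at h
  obtain ⟨hA, ⟨hS, -⟩, hU⟩ := h
  have hQ : ∀ n, σ.Q k n ω = σ.Q k n ω' := fun n => congrArg (σ.query k · n) hU
  refine Prod.ext (funext fun n => ?_) (funext hQ)
  by_cases hn : n ∈ X
  · exact congrArg₂ (σ.answer n) (hQ n) (congrFun hS ⟨n, hn⟩)
  · exact congrFun hA ⟨n, Finset.mem_compl.2 hn⟩

theorem add_residual_insert_le {X : Finset (Fin N)} (hX : σ.SecureAgainst X) (h : σ.Decodable)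
    {J : Finset (Fin K)} {k : Fin K} (hk : k ∉ J) :
    σ.L + σ.residual X (insert k J) k ≤ σ.residual X J k := by
  set q := Fintype.card F
  let answers : σ.Outcome → (n : ↥Xᶜ) → Fin (σ.answerLen n) → F := fun ω n => σ.A k n ω
  calc σ.L + σ.residual X (insert k J) k
      ≤ condEntropy q σ.law (fun ω => σ.W ω k) (σ.side X J) +
          condEntropy q σ.law answers (fun ω => (σ.W ω k, σ.side X J ω)) := by
        refine add_le_add (hX.le_condEntropy_message σ hk) ?_
        refine condEntropy_le_of_factorsThrough_right q _ _ fun ω ω' h => ?_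
        simp only [side, Prod.mk.injEq] at h ⊢
        obtain ⟨⟨hS, hW⟩, hU⟩ := h
        exact ⟨congrFun hW ⟨k, Finset.mem_insert_self k J⟩,
          ⟨hS, funext fun j => congrFun hW ⟨j, Finset.mem_insert_of_mem j.2⟩⟩, hU⟩
    _ = condEntropy q σ.law (fun ω => (answers ω, σ.W ω k)) (σ.side X J) :=
        (condEntropy_pair ..).symm
    _ ≤ condEntropy q σ.law (fun ω => (σ.W ω k, answers ω)) (σ.side X J) :=
        condEntropy_le_of_factorsThrough_left q _ _ fun _ _ h => congrArg Prod.swap h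
    _ = σ.residual X J k := by
        rw [condEntropy_pair, h.condEntropy_message_eq_zero, add_zero, residual]

theorem residual_le_card_compl_mul (h : ∀ n, σ.PrivateAgainst {n}) (X : Finset (Fin N))
    (J : Finset (Fin K)) (k k' : Fin K) :
    σ.residual X J k' ≤ Xᶜ.card * σ.residual X J k :=
  calc σ.residual X J k'
      ≤ ∑ n ∈ Xᶜ, condEntropy (Fintype.card F) σ.law (σ.A k' n) (σ.side X J) :=
        condEntropy_pi_le_sum ..
    _ = ∑ n ∈ Xᶜ, condEntropy (Fintype.card F) σ.law (σ.A k n) (σ.side X J) :=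
        Finset.sum_congr rfl fun n _ => σ.condEntropy_answer_side_eq (h n) X J _ k' k
    _ ≤ ∑ _n ∈ Xᶜ, σ.residual X J k :=
        Finset.sum_le_sum fun n hn =>
          condEntropy_le_of_factorsThrough_left _ _ _ fun _ _ h => congrFun h ⟨n, hn⟩
    _ = Xᶜ.card * σ.residual X J k := by rw [Finset.sum_const, nsmul_eq_mul]

theorem geom_sum_le_residual {X : Finset (Fin N)} (hX : σ.SecureAgainst X)
    (hpriv : ∀ n, σ.PrivateAgainst {n}) (hdec : σ.Decodable) (m : ℕ) :
    ∀ (J : Finset (Fin K)) (k : Fin K), k ∉ J → J.card + m < K →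
      σ.L * ∑ i ∈ Finset.range (m + 1), (1 / (Xᶜ.card : ℝ)) ^ i ≤ σ.residual X J k := by
  induction m with
  | zero =>
    intro J k hk _
    have hstep := σ.add_residual_insert_le hX hdec hk
    have := σ.residual_nonneg X (insert k J) k
    simpa using by linarith
  | succ m ih =>
    intro J k hk hJ
    have hcard : (insert k J).card + m < K := by rw [Finset.card_insert_of_notMem hk]; omega
    obtain ⟨k', hk'⟩ : ∃ k', k' ∉ insert k J := by
      by_contra! hall
      have := Finset.card_le_card fun j (_ : j ∈ Finset.univ) => hall j
      rw [Finset.card_univ, Fintype.card_fin] at this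
      omega
    have hstep := σ.add_residual_insert_le hX hdec hk
    have hmul := (ih _ k' hk' hcard).trans (σ.residual_le_card_compl_mul hpriv X _ k k')
    have hdiv := div_le_of_le_mul₀ (Nat.cast_nonneg _) (σ.residual_nonneg X _ k)
      (hmul.trans_eq (mul_comm _ _))
    rw [geom_sum_succ, mul_add, mul_one]
    calc _ = σ.L * (∑ i ∈ Finset.range (m + 1), (1 / (Xᶜ.card : ℝ)) ^ i) / Xᶜ.card + σ.L := by
          ring
      _ ≤ σ.residual X J k := by linarith

theorem geom_sum_le_sum_entropy {X : Finset (Fin N)} (hX : σ.SecureAgainst X)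
    (hpriv : ∀ n, σ.PrivateAgainst {n}) (hdec : σ.Decodable) (k : Fin K) :
    σ.L * ∑ i ∈ Finset.range K, (1 / (Xᶜ.card : ℝ)) ^ i ≤
      ∑ n ∈ Xᶜ, entropy (Fintype.card F) σ.law (σ.A k n) := by
  have hres := σ.geom_sum_le_residual hX hpriv hdec (K - 1) ∅ k (Finset.notMem_empty k) <| by
    rw [Finset.card_empty, zero_add]
    exact Nat.sub_lt (NeZero.pos K) one_pos
  rw [Nat.sub_add_cancel NeZero.one_le] at hres
  calc σ.L * ∑ i ∈ Finset.range K, (1 / (Xᶜ.card : ℝ)) ^ i ≤ σ.residual X ∅ k := hres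
    _ ≤ ∑ n ∈ Xᶜ, condEntropy (Fintype.card F) σ.law (σ.A k n) (σ.side X ∅) :=
        condEntropy_pi_le_sum ..
    _ ≤ ∑ n ∈ Xᶜ, entropy (Fintype.card F) σ.law (σ.A k n) :=
        Finset.sum_le_sum fun n _ => condEntropy_le_entropy ..

end Scheme

/-! ### Sharing a replicated scheme within groups -/

theorem map_uniformOfFintype_eq_of_equiv [Fintype α] [Nonempty α] [Fintype β] [Nonempty β]
    (e : α ≃ β) {f : α → γ} {f' : β → γ} (h : ∀ a, f a = f' (e a)) :
    (PMF.uniformOfFintype α).map f = (PMF.uniformOfFintype β).map f' := by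
  have hmap : (PMF.uniformOfFintype α).map e = PMF.uniformOfFintype β := by
    ext b
    rw [PMF.map_apply, tsum_eq_single (e.symm b) fun a ha =>
      if_neg fun hb => ha (e.eq_symm_apply.2 hb.symm), if_pos (e.apply_symm_apply b).symm,
      PMF.uniformOfFintype_apply, PMF.uniformOfFintype_apply, Fintype.card_congr e]
  rw [← hmap, PMF.map_comp]
  exact congrArg₂ PMF.map (funext h) rfl

/-- A retrieval scheme for servers, indexed by `ι`, that all store the messages themselves: the
answers are additive in the messages, the key is uniform, and the law of the query to a single
server does not depend on the index of the wanted message. -/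
structure AdditivePIR (F : Type) [AddCommGroup F] (ι : Type) (K : ℕ) where
  L : ℕ
  L_pos : 0 < L
  Key : Type
  [fintypeKey : Fintype Key]
  [nonemptyKey : Nonempty Key]
  Query : Type
  [fintypeQuery : Fintype Query]
  answerLen : ℕ
  query : Fin K → Key → ι → Query
  answer : Query → (Fin K → Fin L → F) →+ (Fin answerLen → F)
  map_query_eq : ∀ i k k', (PMF.uniformOfFintype Key).map (fun u => query k u i) =
    (PMF.uniformOfFintype Key).map (fun u => query k' u i)
  decodable : ∀ k u w w', (∀ i, answer (query k u i) w = answer (query k u i) w') → w k = w' k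

attribute [instance] AdditivePIR.fintypeKey AdditivePIR.nonemptyKey AdditivePIR.fintypeQuery

/-- The symbols of all messages, listed as one vector. -/
def vecEquiv (F : Type) (K L : ℕ) : (Fin K → Fin L → F) ≃ (Fin (K * L) → F) :=
  (Equiv.curry (Fin K) (Fin L) F).symm.trans (finProdFinEquiv.arrowCongr (Equiv.refl F))

section Share

variable {N : ℕ} {ι V : Type} [AddCommGroup V]

/-- The family indexed by the servers with the value `f i` at the server `x i`, which `c` assigns to
the group `i`, and `0` elsewhere. -/
def groupSingle (c : Fin N → Option ι) (x : ι → Fin N) (f : ι → V) (n : Fin N) : V :=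
  (c n).elim 0 fun i => if n = x i then f i else 0

theorem groupSingle_eq_zero {c : Fin N → Option ι} {x : ι → Fin N} {n : Fin N}
    (hn : ∀ i, n ≠ x i) (f : ι → V) : groupSingle c x f n = 0 := by
  rw [groupSingle]
  cases c n with
  | none => rfl
  | some i => exact if_neg (hn i)

variable [DecidableEq ι]

/-- The members of the group `i`, where `c` assigns a group to every server that is in use. -/
def members (c : Fin N → Option ι) (i : ι) : Finset (Fin N) :=
  Finset.univ.filter fun n => c n = some i

theorem mem_members {c : Fin N → Option ι} {i : ι} {n : Fin N} :
    n ∈ members c i ↔ c n = some i := by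
  rw [members, Finset.mem_filter_univ]

variable {c : Fin N → Option ι} {x : ι → Fin N}

theorem sum_members_groupSingle {i : ι} (hx : x i ∈ members c i) (f : ι → V) :
    ∑ n ∈ members c i, groupSingle c x f n = f i := by
  have hn : ∀ n ∈ members c i, groupSingle c x f n = if n = x i then f i else 0 := fun n hn => by
    rw [groupSingle, mem_members.1 hn, Option.elim_some]
  rw [Finset.sum_congr rfl hn, Finset.sum_ite_eq' (members c i), if_pos hx]

/-- Additive secret sharing within each group: the share is the noise, corrected at the member
`x i` of the group `i` so that the shares of each group add up to `w`. -/
def share (c : Fin N → Option ι) (x : ι → Fin N) (n : Fin N) (w : V) (z : Fin N → V) : V :=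
  z n + groupSingle c x (fun i => w - ∑ m ∈ members c i, z m) n

theorem sum_members_share {i : ι} (hx : x i ∈ members c i) (w : V) (z : Fin N → V) :
    ∑ n ∈ members c i, share c x n w z = w := by
  simp only [share, Finset.sum_add_distrib, sum_members_groupSingle hx, add_sub_cancel]

theorem share_eq_share_add_groupSingle {y : ι → Fin N} (hy : ∀ i, y i ∈ members c i) {n : Fin N}
    (hn : ∀ i, n ≠ y i) (w w' : V) (z : Fin N → V) :
    share c x n w z = share c x n w' (z + groupSingle c y fun _ => w' - w) := by
  have hres : ∀ i, w' - ∑ m ∈ members c i, (z + groupSingle c y fun _ => w' - w) m =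
      w - ∑ m ∈ members c i, z m := fun i => by
    simp only [Pi.add_apply, Finset.sum_add_distrib, sum_members_groupSingle (hy i)]
    abel
  rw [share, share, funext hres, Pi.add_apply, groupSingle_eq_zero hn, add_zero]

end Share

namespace Scheme

variable {F : Type} {N K : ℕ} [Field F] [Fintype F] [NeZero K]

theorem decodable_of_forall (σ : Scheme F N K)
    (h : ∀ k (ω ω' : σ.Outcome), (∀ n, σ.A k n ω = σ.A k n ω') →
      (∀ n, σ.Q k n ω = σ.Q k n ω') → σ.W ω k = σ.W ω' k) : σ.Decodable := fun k =>
  condEntropy_eq_zero_of_factorsThrough _ _ fun ω ω' hAQ =>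
    h k ω ω' (congrFun (Prod.ext_iff.1 hAQ).1) (congrFun (Prod.ext_iff.1 hAQ).2)

theorem map_U (σ : Scheme F N K) : σ.law.map σ.U = σ.keyLaw :=
  map_eq_of_map_pair_eq_bind σ.law_map_key_data

end Scheme

namespace AdditivePIR

variable {F : Type} {N K : ℕ} {ι : Type} [Field F] [Fintype F] [DecidableEq ι]

/-- Every server of `π` is replaced by the group of servers that `c` assigns to it: the messages
are shared within the group, whose members all receive the query of `π`. Servers outside the groups
are not queried. -/
abbrev scheme (π : AdditivePIR F ι K) (c : Fin N → Option ι) (x : ι → Fin N) : Scheme F N K where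
  L := π.L
  L_pos := π.L_pos
  Noise := Fin N → Fin K → Fin π.L → F
  noiseLaw := PMF.uniformOfFintype _
  Key := π.Key
  keyLaw := PMF.uniformOfFintype _
  Query := Option π.Query
  storageLen _ := K * π.L
  answerLen _ := π.answerLen
  encode n w z := vecEquiv F K π.L (share c x n w z)
  query k u n := (c n).map (π.query k u)
  answer _ q s := q.elim 0 fun q => π.answer q ((vecEquiv F K π.L).symm s)

variable (π : AdditivePIR F ι K) {c : Fin N → Option ι} {x : ι → Fin N}

theorem scheme_answer (k : Fin K) {n : Fin N} {i : ι} (hn : n ∈ members c i)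
    (ω : (π.scheme c x).Outcome) :
    (π.scheme c x).A k n ω = π.answer (π.query k ω.2.2.1 i) (share c x n ω.1 ω.2.1) := by
  simp only [Scheme.A, Scheme.Q, Scheme.S, mem_members.1 hn, Option.map_some, Option.elim_some,
    Equiv.symm_apply_apply]

variable [NeZero K]

theorem scheme_secureAgainst {X : Finset (Fin N)} (hX : ∀ i, ¬members c i ⊆ X) :
    (π.scheme c x).SecureAgainst X := by
  choose y hy hyX using fun i => Finset.not_subset.1 (hX i)
  refine ((π.scheme c x).secureAgainst_iff X).2 fun w w' => ?_
  refine map_uniformOfFintype_eq_of_equiv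
    (Equiv.addRight (groupSingle c y fun _ => w' - w)) fun z => funext fun n => ?_
  exact congrArg (vecEquiv F K π.L)
    (share_eq_share_add_groupSingle hy (fun i h => hyX i (h ▸ n.2)) w w' z)

theorem scheme_privateAgainst {T : Finset (Fin N)} {o : Option ι} (hT : ∀ n ∈ T, c n = o) :
    (π.scheme c x).PrivateAgainst T := by
  refine ((π.scheme c x).privateAgainst_iff T).2 fun k k' => ?_
  have hquery : ∀ k, (fun u (n : T) => (π.scheme c x).query k u n) =
      fun u _ => o.map (π.query k u) := fun k => funext fun u => funext fun n => by
    simp only [hT n n.2]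
  rw [hquery, hquery]
  cases o with
  | none => rfl
  | some i =>
    have hcomp : ∀ k, (fun u (_ : T) => (some i).map (π.query k u)) =
        (fun q _ => some q) ∘ fun u => π.query k u i := fun k => rfl
    rw [hcomp, hcomp, ← PMF.map_comp, ← PMF.map_comp, π.map_query_eq i k k']

theorem scheme_decodable (hx : ∀ i, x i ∈ members c i) : (π.scheme c x).Decodable := by
  refine Scheme.decodable_of_forall _ fun k ω ω' hA hQ =>
    π.decodable k ω.2.2.1 ω.1 ω'.1 fun i => ?_
  have hquery : π.query k ω'.2.2.1 i = π.query k ω.2.2.1 i := by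
    simpa only [Scheme.Q, mem_members.1 (hx i), Option.map_some, Option.some_inj] using
      (hQ (x i)).symm
  rw [← sum_members_share (hx i) ω.1 ω.2.1, ← sum_members_share (hx i) ω'.1 ω'.2.1, map_sum,
    map_sum]
  refine Finset.sum_congr rfl fun n hn => ?_
  rw [← π.scheme_answer k hn, hA n, π.scheme_answer k hn, hquery]

theorem scheme_isAdmissible (hx : ∀ i, x i ∈ members c i) {𝒳 𝒯 : Finset (Finset (Fin N))}
    (hcard : ∀ i, 2 ≤ (members c i).card) (h𝒳 : ∀ X ∈ 𝒳, ∀ i, ¬members c i ⊆ X)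
    (h𝒯 : ∀ T ∈ 𝒯, ∃ i, T ⊆ members c i) : (π.scheme c x).IsAdmissible 𝒳 𝒯 where
  secure_single n := π.scheme_secureAgainst fun i hi =>
    absurd (Finset.card_le_card hi) (by rw [Finset.card_singleton]; exact not_le.2 (hcard i))
  secure_link X hX := π.scheme_secureAgainst (h𝒳 X hX)
  private_single n := π.scheme_privateAgainst (o := c n) (by simp)
  private_collusion T hT := by
    obtain ⟨i, hi⟩ := h𝒯 T hT
    exact π.scheme_privateAgainst fun n hn => mem_members.1 (hi hn)
  decodable := π.scheme_decodable hx

theorem sum_entropy_scheme_le [Fintype ι] (k : Fin K) {s : ℕ} (hs : ∀ i, (members c i).card = s)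
    {b : ι → ℝ} (hb : ∀ i, ∀ n ∈ members c i,
      entropy (Fintype.card F) (π.scheme c x).law ((π.scheme c x).A k n) ≤ b i) :
    ∑ n, entropy (Fintype.card F) (π.scheme c x).law ((π.scheme c x).A k n) ≤ s * ∑ i, b i := by
  have hunused : ∀ n ∈ Finset.univ.filter (c · = none),
      entropy (Fintype.card F) (π.scheme c x).law ((π.scheme c x).A k n) ≤ 0 := fun n hn => by
    have hzero : (π.scheme c x).A k n = fun _ => 0 := funext fun ω => by
      simp only [Scheme.A, Scheme.Q, (Finset.mem_filter.1 hn).2, Option.map_none, Option.elim_none]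
    rw [hzero]
    refine (entropy_le_of_factorsThrough _ _ (X := fun _ => ()) fun _ _ _ => rfl).trans ?_
    exact (entropy_le_logb_card _ _ _).trans_eq (by simp)
  rw [← Finset.sum_fiberwise Finset.univ c, Fintype.sum_option, Finset.mul_sum]
  refine add_le_of_nonpos_of_le (Finset.sum_nonpos hunused) (Finset.sum_le_sum fun i _ => ?_)
  rw [← hs i, ← nsmul_eq_mul]
  exact Finset.sum_le_card_nsmul _ _ _ (hb i)

theorem entropy_scheme_answer_le (k : Fin K) (n : Fin N) :
    entropy (Fintype.card F) (π.scheme c x).law ((π.scheme c x).A k n) ≤ π.answerLen :=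
  (entropy_le_logb_card _ _ _).trans_eq (by rw [logb_card_vec, Fintype.card_fin])

theorem entropy_scheme_answer_le_of_answer_eq_zero (k : Fin K) {i : ι} {n : Fin N}
    (hn : n ∈ members c i) {u : π.Key} (hu : π.answer (π.query k u i) = 0) :
    entropy (Fintype.card F) (π.scheme c x).law ((π.scheme c x).A k n) ≤
      1 + (1 - 1 / Fintype.card π.Key) * π.answerLen := by
  have hprob : 1 / (Fintype.card π.Key : ℝ) ≤
      prob (π.scheme c x).law ((π.scheme c x).A k n) 0 :=
    calc 1 / (Fintype.card π.Key : ℝ)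
        = prob (π.scheme c x).law (π.scheme c x).U u := by
          rw [prob, Scheme.map_U, PMF.uniformOfFintype_apply, ENNReal.toReal_inv,
            ENNReal.toReal_natCast, one_div]
      _ ≤ prob (π.scheme c x).law ((π.scheme c x).A k n) 0 := prob_mono _ fun ω hω => by
          rw [π.scheme_answer k hn, ← Scheme.U, hω, hu, AddMonoidHom.zero_apply]
  refine (entropy_le_one_add_mul_logb_card Fintype.one_lt_card _ _ 0).trans ?_
  rw [logb_card_vec, Fintype.card_fin]
  gcongr

end AdditivePIR

/-! ### Retrieval from replicated servers -/

section Packets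

variable {F G : Type} [AddCommGroup F] [AddCommGroup G] [Fintype G] [DecidableEq G] {ℓ K : ℕ}

/-- The symbols of a message form a packet of length `ℓ` for each nonzero element of `G`. -/
def packetEquiv (G : Type) [Zero G] [Fintype G] [DecidableEq G] (ℓ : ℕ) :
    {x : G // x ≠ 0} × Fin ℓ ≃ Fin ((Fintype.card G - 1) * ℓ) :=
  Fintype.equivFinOfCardEq <| by
    rw [Fintype.card_prod, Fintype.card_fin, Fintype.card_subtype_compl, Fintype.card_subtype_eq]

/-- The packet of a message at `x`, with the convention that the packet at `0` vanishes. -/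
def packet (x : G) : (Fin ((Fintype.card G - 1) * ℓ) → F) →+ (Fin ℓ → F) :=
  if hx : x ≠ 0 then
    { toFun := fun v t => v (packetEquiv G ℓ (⟨x, hx⟩, t))
      map_zero' := rfl
      map_add' := fun _ _ => rfl }
  else 0

theorem packet_zero : packet (F := F) (ℓ := ℓ) (0 : G) = 0 := dif_neg (not_not.2 rfl)

theorem packet_of_ne_zero {x : G} (hx : x ≠ 0) (v : Fin ((Fintype.card G - 1) * ℓ) → F) :
    packet x v = fun t => v (packetEquiv G ℓ (⟨x, hx⟩, t)) := by
  rw [packet, dif_pos hx, AddMonoidHom.coe_mk, ZeroHom.coe_mk]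

theorem eq_of_forall_packet_eq {v v' : Fin ((Fintype.card G - 1) * ℓ) → F}
    (h : ∀ x : G, packet x v = packet x v') : v = v' := by
  funext s
  obtain ⟨⟨⟨x, hx⟩, t⟩, rfl⟩ := (packetEquiv G ℓ).surjective s
  simpa only [packet_of_ne_zero hx] using congrFun (h x) t

/-- The sum of one packet of each message, the `j`-th of them at `y j`. -/
def packetSum (y : Fin K → G) :
    (Fin K → Fin ((Fintype.card G - 1) * ℓ) → F) →+ (Fin ℓ → F) :=
  ∑ j, (packet (y j)).comp (Pi.evalAddMonoidHom _ j)

theorem packetSum_apply (y : Fin K → G) (w : Fin K → Fin ((Fintype.card G - 1) * ℓ) → F) :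
    packetSum y w = ∑ j, packet (y j) (w j) := by
  simp only [packetSum, AddMonoidHom.finsetSum_apply, AddMonoidHom.comp_apply,
    Pi.evalAddMonoidHom_apply]

theorem packetSum_zero : packetSum (F := F) (ℓ := ℓ) (0 : Fin K → G) = 0 :=
  AddMonoidHom.ext fun w => by
    simp only [packetSum_apply, Pi.zero_apply, packet_zero, AddMonoidHom.zero_apply,
      Finset.sum_const_zero]

theorem packetSum_add_single (u : Fin K → G) (k : Fin K) (i : G)
    (w : Fin K → Fin ((Fintype.card G - 1) * ℓ) → F) :
    packetSum (u + Pi.single k i) w =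
      packet (u k + i) (w k) + ∑ j ∈ Finset.univ.erase k, packet (u j) (w j) := by
  rw [packetSum_apply, ← Finset.add_sum_erase _ _ (Finset.mem_univ k), Pi.add_apply,
    Pi.single_eq_same]
  refine congrArg _ (Finset.sum_congr rfl fun j hj => ?_)
  rw [Pi.add_apply, Pi.single_eq_of_ne (Finset.ne_of_mem_erase hj), add_zero]

theorem eq_of_forall_packetSum_add_single_eq {u : Fin K → G} {k : Fin K}
    {w w' : Fin K → Fin ((Fintype.card G - 1) * ℓ) → F}
    (h : ∀ i, packetSum (u + Pi.single k i) w = packetSum (u + Pi.single k i) w') :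
    w k = w' k := by
  simp only [packetSum_add_single] at h
  -- The answer for `i = -u k` consists of the interference alone, since the packet at `0` vanishes.
  have hinterference : ∑ j ∈ Finset.univ.erase k, packet (u j) (w j) =
      ∑ j ∈ Finset.univ.erase k, packet (u j) (w' j) := by
    simpa only [add_neg_cancel, packet_zero, AddMonoidHom.zero_apply, zero_add] using h (-u k)
  refine eq_of_forall_packet_eq fun x => ?_
  have hx := h (x - u k)
  rwa [hinterference, add_left_inj, add_sub_cancel] at hx

end Packets

section ZeroSum

variable (G : Type) [AddCommGroup G] (K : ℕ)

/-- The families of `K` elements with sum `0`; the user draws the key from them. -/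
def zeroSum : AddSubgroup (Fin K → G) := (∑ j, Pi.evalAddMonoidHom (fun _ : Fin K => G) j).ker

variable {G K}

theorem mem_zeroSum {u : Fin K → G} : u ∈ zeroSum G K ↔ ∑ j, u j = 0 := by
  simp only [zeroSum, AddMonoidHom.mem_ker, AddMonoidHom.finsetSum_apply,
    Pi.evalAddMonoidHom_apply]

theorem single_sub_single_mem_zeroSum (k k' : Fin K) (i : G) :
    Pi.single k i - Pi.single k' i ∈ zeroSum G K := by
  simp [mem_zeroSum]

theorem map_add_single_uniformOfFintype_zeroSum [Fintype (zeroSum G K)] (i : G) (k k' : Fin K) :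
    (PMF.uniformOfFintype (zeroSum G K)).map (fun u => u.1 + Pi.single k i) =
      (PMF.uniformOfFintype (zeroSum G K)).map (fun u => u.1 + Pi.single k' i) := by
  let e := Equiv.addRight (⟨_, single_sub_single_mem_zeroSum k k' i⟩ : zeroSum G K)
  refine map_uniformOfFintype_eq_of_equiv e fun u => ?_
  rw [Equiv.coe_addRight, AddSubgroup.coe_add, add_assoc, sub_add_cancel]

theorem natCard_zeroSum_mul [NeZero K] : Nat.card (zeroSum G K) * Nat.card G = Nat.card G ^ K := by
  have hrange : (∑ j, Pi.evalAddMonoidHom (fun _ : Fin K => G) j).range = ⊤ :=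
    AddMonoidHom.range_eq_top.2 fun x => ⟨Pi.single 0 x, by simp [AddMonoidHom.finsetSum_apply]⟩
  have hcard := (zeroSum G K).card_mul_index
  rwa [zeroSum, AddSubgroup.index_ker, hrange, Nat.card_congr AddSubgroup.topEquiv.toEquiv,
    Nat.card_fun, Nat.card_fin] at hcard

end ZeroSum

theorem sub_one_mul_sum_one_div_pow {x : ℝ} (hx : x ≠ 0) (K : ℕ) :
    (x - 1) * ∑ i ∈ Finset.range K, (1 / x) ^ i = x - x / x ^ K := by
  have hgeom := mul_geom_sum (1 / x) K
  calc (x - 1) * ∑ i ∈ Finset.range K, (1 / x) ^ i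
      = -x * ((1 / x - 1) * ∑ i ∈ Finset.range K, (1 / x) ^ i) := by field_simp; ring
    _ = x - x / x ^ K := by rw [hgeom, one_div, inv_pow]; ring

theorem sum_one_div_pow_pos (g K : ℕ) [NeZero K] :
    0 < ∑ i ∈ Finset.range K, (1 / (g : ℝ)) ^ i :=
  Finset.sum_pos' (fun i _ => by positivity) ⟨0, by simp [NeZero.pos K], by simp⟩

namespace AdditivePIR

/-- The scheme of Tian, Sun and Chen, with servers indexed by a finite group `G` and symbols
replaced by packets of length `ℓ`: the entries of the query to the server `i`
add up to `i`. -/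
def zeroSumPIR (F G : Type) [AddCommGroup F] [AddCommGroup G] [Fintype G] [DecidableEq G]
    [Nontrivial G] (K : ℕ) {ℓ : ℕ} (hℓ : 0 < ℓ) : AdditivePIR F G K where
  L := (Fintype.card G - 1) * ℓ
  L_pos := Nat.mul_pos (Nat.sub_pos_of_lt Fintype.one_lt_card) hℓ
  Key := zeroSum G K
  fintypeKey := Fintype.ofFinite _
  Query := Fin K → G
  answerLen := ℓ
  query k u i := u.1 + Pi.single k i
  answer := packetSum
  map_query_eq i k k' :=
    let _ : Fintype (zeroSum G K) := Fintype.ofFinite _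
    map_add_single_uniformOfFintype_zeroSum i k k'
  decodable _ u _ _ h := eq_of_forall_packetSum_add_single_eq (u := u.1) (by exact h)

/-- The scheme in which every server is asked for all messages. -/
def fullDownloadPIR (F ι : Type) [AddCommGroup F] [Nonempty ι] (K : ℕ) {ℓ : ℕ} (hℓ : 0 < ℓ) :
    AdditivePIR F ι K where
  L := ℓ
  L_pos := hℓ
  Key := Unit
  Query := Unit
  answerLen := K * ℓ
  query _ _ _ := ()
  answer _ :=
    { toFun := vecEquiv F K ℓ
      map_zero' := rfl
      map_add' := fun _ _ => rfl }
  map_query_eq _ _ _ := rfl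
  decodable k _ _ _ h := congrFun ((vecEquiv F K ℓ).injective (h (Classical.arbitrary ι))) k

variable {F : Type} {N K : ℕ} [Field F] [Fintype F] [NeZero K]

theorem sum_entropy_scheme_fullDownloadPIR_le {ι : Type} [Unique ι] [DecidableEq ι] {ℓ : ℕ}
    (hℓ : 0 < ℓ) {c : Fin N → Option ι} (x : ι → Fin N) {s : ℕ}
    (hs : ∀ i, (members c i).card = s) (k : Fin K) :
    ∑ n, entropy (Fintype.card F) ((fullDownloadPIR F ι K hℓ).scheme c x).law
      (((fullDownloadPIR F ι K hℓ).scheme c x).A k n) ≤ s * (K * ℓ) := by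
  refine (sum_entropy_scheme_le _ k hs fun _ n _ => entropy_scheme_answer_le _ k n).trans_eq ?_
  rw [Fintype.sum_unique, fullDownloadPIR, Nat.cast_mul]

variable {G : Type} [AddCommGroup G] [Fintype G] [DecidableEq G] {c : Fin N → Option G}
  {x : G → Fin N} {s : ℕ}

-- The server `0` sends nothing when the key is `0`, that is, with probability `g / g ^ K`.
theorem sum_entropy_scheme_zeroSumPIR_le [Nontrivial G] {ℓ : ℕ} (hℓ : 0 < ℓ)
    (hs : ∀ i, (members c i).card = s) (k : Fin K) :
    ∑ n, entropy (Fintype.card F) ((zeroSumPIR F G K hℓ).scheme c x).law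
        (((zeroSumPIR F G K hℓ).scheme c x).A k n) ≤
      s * ((Fintype.card G - Fintype.card G / (Fintype.card G : ℝ) ^ K) * ℓ + 1) := by
  let π := zeroSumPIR F G K hℓ
  have hcard : (Fintype.card π.Key : ℝ) = (Fintype.card G : ℝ) ^ K / Fintype.card G := by
    rw [eq_div_iff (Nat.cast_ne_zero.2 Fintype.card_ne_zero), ← Nat.card_eq_fintype_card,
      ← Nat.card_eq_fintype_card]
    exact_mod_cast natCard_zeroSum_mul (G := G) (K := K)
  have hquery : π.query k (0 : zeroSum G K) 0 = (0 : Fin K → G) := by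
    simp only [π, zeroSumPIR, ZeroMemClass.coe_zero, Pi.single_zero, add_zero]
  have hzero : π.answer (π.query k (0 : zeroSum G K) 0) = 0 :=
    (congrArg π.answer hquery).trans packetSum_zero
  refine (π.sum_entropy_scheme_le k hs
    (b := fun i => (ℓ : ℝ) + if i = 0 then 1 - (ℓ : ℝ) / Fintype.card π.Key else 0)
    fun i n hn => ?_).trans_eq ?_
  · split_ifs with hi
    · refine (π.entropy_scheme_answer_le_of_answer_eq_zero k (hi ▸ hn) hzero).trans_eq ?_
      simp only [π, zeroSumPIR]
      ring
    · exact (π.entropy_scheme_answer_le k n).trans_eq (add_zero (ℓ : ℝ)).symm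
  · rw [Finset.sum_add_distrib, Finset.sum_const, Finset.card_univ, nsmul_eq_mul,
      Finset.sum_ite_eq', if_pos (Finset.mem_univ _), hcard, div_div_eq_mul_div]
    ring

end AdditivePIR

theorem exists_isAdmissible_sum_entropy_le (F : Type) [Field F] [Fintype F] {N : ℕ} (K : ℕ)
    [NeZero K] {G : Type} [AddCommGroup G] [Fintype G] [DecidableEq G] {c : Fin N → Option G}
    {s : ℕ} (hs : ∀ i, (members c i).card = s) (hs2 : 2 ≤ s) {𝒳 𝒯 : Finset (Finset (Fin N))}
    (h𝒳 : ∀ X ∈ 𝒳, ∀ i, ¬members c i ⊆ X) (h𝒯 : ∀ T ∈ 𝒯, ∃ i, T ⊆ members c i) {ℓ : ℕ}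
    (hℓ : 0 < ℓ) :
    ∃ σ : Scheme F N K, σ.IsAdmissible 𝒳 𝒯 ∧ ℓ ≤ σ.L ∧
      ∀ k, ∑ n, entropy (Fintype.card F) σ.law (σ.A k n) ≤
        s * (σ.L * ∑ i ∈ Finset.range K, (1 / (Fintype.card G : ℝ)) ^ i + 1) := by
  have hcard : ∀ i, 2 ≤ (members c i).card := fun i => hs2.trans_eq (hs i).symm
  choose x hx using fun i => Finset.card_pos.1 (two_pos.trans_le (hcard i))
  cases subsingleton_or_nontrivial G with
  | inl _ =>
    let _ : Unique G := uniqueOfSubsingleton 0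
    let π := AdditivePIR.fullDownloadPIR F G K hℓ
    refine ⟨π.scheme c x, π.scheme_isAdmissible hx hcard h𝒳 h𝒯, le_rfl, fun k =>
      (AdditivePIR.sum_entropy_scheme_fullDownloadPIR_le hℓ x hs k).trans ?_⟩
    have hL : (π.L : ℝ) = ℓ := rfl
    simp only [hL, Fintype.card_unique, Nat.cast_one, div_one, one_pow, Finset.sum_const,
      Finset.card_range, nsmul_eq_mul, mul_one]
    gcongr
    linarith
  | inr _ =>
    let π := AdditivePIR.zeroSumPIR F G K hℓ
    refine ⟨π.scheme c x, π.scheme_isAdmissible hx hcard h𝒳 h𝒯,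
      Nat.le_mul_of_pos_left ℓ (Nat.sub_pos_of_lt Fintype.one_lt_card), fun k =>
      (AdditivePIR.sum_entropy_scheme_zeroSumPIR_le hℓ hs k).trans_eq ?_⟩
    have hL : (π.L : ℝ) = (Fintype.card G - 1) * ℓ := by
      simp only [π, AdditivePIR.zeroSumPIR]
      rw [Nat.cast_mul, Nat.cast_sub Fintype.card_pos, Nat.cast_one]
    rw [hL, mul_right_comm,
      sub_one_mul_sum_one_div_pow (Nat.cast_ne_zero.2 Fintype.card_ne_zero)]

theorem Scheme.sum_entropy_answer_pos {F : Type} [Field F] [Fintype F] {N K : ℕ} [NeZero K]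
    (σ : Scheme F N K) {X : Finset (Fin N)} (hX : σ.SecureAgainst X)
    (hpriv : ∀ n, σ.PrivateAgainst {n}) (hdec : σ.Decodable) (k : Fin K) :
    0 < ∑ n, entropy (Fintype.card F) σ.law (σ.A k n) := by
  calc (0 : ℝ) < σ.L * ∑ i ∈ Finset.range K, (1 / (Xᶜ.card : ℝ)) ^ i :=
        mul_pos (Nat.cast_pos.2 σ.L_pos) (sum_one_div_pow_pos _ K)
    _ ≤ ∑ n ∈ Xᶜ, entropy (Fintype.card F) σ.law (σ.A k n) :=
        σ.geom_sum_le_sum_entropy hX hpriv hdec k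
    _ ≤ ∑ n, entropy (Fintype.card F) σ.law (σ.A k n) :=
        Finset.sum_le_univ_sum_of_nonneg fun n => entropy_nonneg _ _ _

theorem le_of_mem_upperBounds_achievableRates {F : Type} [Field F] [Fintype F] {N K : ℕ}
    [NeZero K] {G : Type} [AddCommGroup G] [Fintype G] [DecidableEq G] {c : Fin N → Option G}
    {s : ℕ} (hs : ∀ i, (members c i).card = s) (hs2 : 2 ≤ s) {𝒳 𝒯 : Finset (Finset (Fin N))}
    (h𝒳 : ∀ X ∈ 𝒳, ∀ i, ¬members c i ⊆ X) (h𝒯 : ∀ T ∈ 𝒯, ∃ i, T ⊆ members c i) {R : ℝ}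
    (hR : R ∈ upperBounds (achievableRates F N K 𝒳 𝒯)) :
    (s * ∑ i ∈ Finset.range K, (1 / (Fintype.card G : ℝ)) ^ i)⁻¹ ≤ R := by
  set D : ℝ := ∑ i ∈ Finset.range K, (1 / (Fintype.card G : ℝ)) ^ i
  have : (0 : ℝ) < s := Nat.cast_pos.2 (two_pos.trans_le hs2)
  have hD : 0 < D := sum_one_div_pow_pos _ K
  have hrate : ∀ t : ℕ, (s * (D + 1 / ((t : ℝ) + 1)))⁻¹ ≤ R := fun t => by
    obtain ⟨σ, hσ, htL, hdownload⟩ :=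
      exists_isAdmissible_sum_entropy_le F K hs hs2 h𝒳 h𝒯 t.succ_pos
    have hL : (0 : ℝ) < σ.L := Nat.cast_pos.2 σ.L_pos
    refine hR ⟨σ, hσ, fun k => ?_⟩
    obtain ⟨n, -⟩ : (members c 0).Nonempty := Finset.card_pos.1 (by rw [hs]; omega)
    calc (s * (D + 1 / ((t : ℝ) + 1)))⁻¹ ≤ (s * (D + 1 / σ.L))⁻¹ := by
          gcongr; exact_mod_cast htL
      _ = σ.L / (s * (σ.L * D + 1)) := by field_simp
      _ ≤ σ.rate k := div_le_div_of_nonneg_left hL.le (σ.sum_entropy_answer_pos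
          (hσ.secure_single n) hσ.private_single hσ.decodable k) (hdownload k)
  have hlim : Filter.Tendsto (fun t : ℕ => (s * (D + 1 / ((t : ℝ) + 1)))⁻¹) Filter.atTop
      (nhds (s * (D + 0))⁻¹) :=
    ((tendsto_one_div_add_atTop_nhds_zero_nat.const_add D).const_mul _).inv₀
      (by rw [add_zero]; positivity)
  rw [add_zero] at hlim
  exact le_of_tendsto' hlim hrate

/-! ### Groupings -/

section Grouping

variable {N M : ℕ} {B : Matrix (Fin N) (Fin M) ℕ} {Λ : SimilarityMatrix N}

theorem IsBinary.compl_apply (hB : IsBinary B) (n : Fin N) (m : Fin M) :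
    compl B n m = if n ∈ (link B m)ᶜ then 1 else 0 := by
  rcases hB n m with h | h <;> simp [compl, link, h]

theorem sum_sum_compl_link_le {R : Type} [CommSemiring R] [PartialOrder R] [IsOrderedRing R]
    (hB : IsBinary B) {f : Fin N → R} (hf : ∀ n, 0 ≤ f n) :
    ∑ m, ∑ n ∈ (link B m)ᶜ, f n ≤ lam B * ∑ n, f n :=
  calc ∑ m, ∑ n ∈ (link B m)ᶜ, f n = ∑ m, ∑ n, (compl B n m : R) * f n := by
        simp only [hB.compl_apply, Nat.cast_ite, Nat.cast_one, Nat.cast_zero, ite_mul, one_mul,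
          zero_mul, Finset.sum_ite_mem, Finset.univ_inter]
    _ = ∑ n, ((∑ m, compl B n m : ℕ) : R) * f n := by
        rw [Finset.sum_comm]
        simp only [Nat.cast_sum, Finset.sum_mul]
    _ ≤ ∑ n, lam B * f n := Finset.sum_le_sum fun n _ => mul_le_mul_of_nonneg_right
        (Nat.mono_cast (Finset.le_sup (f := fun n => ∑ m, compl B n m) (Finset.mem_univ n)))
        (hf n)
    _ = lam B * ∑ n, f n := (Finset.mul_sum _ _ _).symm

theorem le_lam_mul_card (hB : IsBinary B) {T : Finset (Fin N)} (hT : ∀ m, ¬T ⊆ link B m) :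
    M ≤ lam B * T.card := by
  have hmeet : ∀ m, 1 ≤ ∑ n ∈ (link B m)ᶜ, if n ∈ T then 1 else 0 := fun m => by
    obtain ⟨n, hnT, hnm⟩ := Finset.not_subset.1 (hT m)
    rw [Finset.sum_boole, Nat.cast_id]
    exact Finset.card_pos.2 ⟨n, Finset.mem_filter.2 ⟨Finset.mem_compl.2 hnm, hnT⟩⟩
  calc M = ∑ _ : Fin M, 1 := by simp
    _ ≤ ∑ m, ∑ n ∈ (link B m)ᶜ, if n ∈ T then 1 else 0 :=
        Finset.sum_le_sum fun m _ => hmeet m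
    _ ≤ lam B * ∑ n, if n ∈ T then 1 else 0 :=
        sum_sum_compl_link_le hB fun n => Nat.zero_le _
    _ = lam B * T.card := by simp

theorem mem_groups {T : Finset (Fin N)} :
    T ∈ groups Λ ↔ ∃ i, Matrix.row Λ i ≠ 0 ∧ group Λ i = T := by
  simp only [groups, Finset.mem_image, Finset.mem_filter_univ]

theorem numGroups_le (Λ : SimilarityMatrix N) : numGroups Λ ≤ N :=
  calc numGroups Λ ≤ ⌈(N : ℚ) / 2⌉₊ := (Finset.card_le_univ _).trans_eq (Fintype.card_fin _)
    _ ≤ N := Nat.ceil_le.2 (half_le_self (Nat.cast_nonneg N))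

namespace IsFeasible

theorem disjoint_group (hΛ : IsFeasible B Λ) {i j : Fin ⌈(N : ℚ) / 2⌉₊} (hij : i ≠ j) :
    Disjoint (group Λ i) (group Λ j) := by
  refine Finset.disjoint_left.2 fun n hi hj => ?_
  have hn := Finset.sum_eq_zero_iff.1 (hΛ.orthogonal i j hij) n (Finset.mem_univ n)
  simp only [group, Finset.mem_filter_univ] at hi hj
  simp [Matrix.row, hi, hj] at hn

theorem card_group (hΛ : IsFeasible B Λ) (i : Fin ⌈(N : ℚ) / 2⌉₊) :
    (group Λ i).card = ∑ j, Λ i j := by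
  rw [group, Finset.card_filter]
  refine Finset.sum_congr rfl fun j _ => ?_
  rcases hΛ.binary i j with h | h <;> simp [h]

theorem not_subset_link (hB : IsBinary B) (hΛ : IsFeasible B Λ) {T : Finset (Fin N)}
    (hT : T ∈ groups Λ) (m : Fin M) : ¬T ⊆ link B m := by
  obtain ⟨i, hi, rfl⟩ := mem_groups.1 hT
  have hsum := hΛ.secure i hi m
  rw [Matrix.mul_apply] at hsum
  obtain ⟨n, -, hn⟩ := Finset.exists_ne_zero_of_sum_ne_zero (Nat.one_le_iff_ne_zero.1 hsum)
  rw [mul_ne_zero_iff, hB.compl_apply, ite_ne_right_iff, Finset.mem_compl] at hn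
  refine Finset.not_subset.2 ⟨n, ?_, hn.2.1⟩
  rw [group, Finset.mem_filter_univ]
  exact (hΛ.binary i n).resolve_left hn.1

theorem two_le_card [NeZero M] (hB : IsBinary B) (hΛ : IsFeasible B Λ) {T : Finset (Fin N)}
    (hT : T ∈ groups Λ) : 2 ≤ T.card := by
  obtain ⟨n, hn, -⟩ := Finset.not_subset.1 (hΛ.not_subset_link hB hT 0)
  have hpos : 0 < T.card := Finset.card_pos.2 ⟨n, hn⟩
  obtain ⟨i, -, rfl⟩ := mem_groups.1 hT
  have hne := hΛ.card_group i ▸ hΛ.no_singleton i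
  omega

theorem sum_card_group_pos [NeZero M] (hB : IsBinary B) (hΛ : IsFeasible B Λ)
    {T : Finset (Fin N)} (hT : T ∈ groups Λ) : 0 < ∑ i, (group Λ i).card := by
  obtain ⟨i, -, rfl⟩ := mem_groups.1 hT
  exact (two_pos.trans_le (hΛ.two_le_card hB hT)).trans_le
    (Finset.single_le_sum (f := fun i => (group Λ i).card) (fun _ _ => Nat.zero_le _)
      (Finset.mem_univ i))

-- Every group has size at least `M / λ`, and the hypothesis says that this is the average size.
theorem lam_mul_card [NeZero M] (hB : IsBinary B) (hΛ : IsFeasible B Λ)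
    (hlam : (lam B : ℝ) / M = numGroups Λ / (∑ i, (group Λ i).card : ℕ)) {T : Finset (Fin N)}
    (hT : T ∈ groups Λ) : lam B * T.card = M := by
  classical
  let used : Finset (Fin ⌈(N : ℚ) / 2⌉₊) := Finset.univ.filter fun i => Matrix.row Λ i ≠ 0
  have hused : ∑ i, (group Λ i).card = ∑ i ∈ used, (group Λ i).card := by
    refine (Finset.sum_subset (Finset.subset_univ _) fun i _ hi => ?_).symm
    have hrow : Matrix.row Λ i = 0 := by simpa [used] using hi
    rw [hΛ.card_group]
    exact Finset.sum_eq_zero fun n _ => congrFun hrow n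
  rw [div_eq_div_iff (NeZero.ne _) (Nat.cast_ne_zero.2 (hΛ.sum_card_group_pos hB hT).ne')] at hlam
  have hsum : ∑ _i ∈ used, M = ∑ i ∈ used, lam B * (group Λ i).card := by
    rw [Finset.sum_const, smul_eq_mul, ← Finset.mul_sum, ← hused]
    exact_mod_cast hlam.symm
  have hle : ∀ i ∈ used, M ≤ lam B * (group Λ i).card := fun i hi =>
    le_lam_mul_card hB (hΛ.not_subset_link hB (mem_groups.2 ⟨i, (Finset.mem_filter.1 hi).2, rfl⟩))
  obtain ⟨i, hi, rfl⟩ := mem_groups.1 hT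
  exact ((Finset.sum_eq_sum_iff_of_le hle).1 hsum i
    (Finset.mem_filter.2 ⟨Finset.mem_univ i, hi⟩)).symm

end IsFeasible

theorem exists_members_eq {ι : Type} [DecidableEq ι] {T : ι → Finset (Fin N)}
    (hT : Pairwise fun i j => Disjoint (T i) (T j)) :
    ∃ c : Fin N → Option ι, ∀ i, members c i = T i := by
  have hassign : ∀ n, ∃ o : Option ι, ∀ i, o = some i ↔ n ∈ T i := fun n => by
    by_cases h : ∃ i, n ∈ T i
    · obtain ⟨i, hi⟩ := h
      refine ⟨some i, fun j => ⟨fun hj => Option.some_injective _ hj ▸ hi, fun hj => ?_⟩⟩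
      exact congrArg some (hT.eq (Finset.not_disjoint_iff.2 ⟨n, hi, hj⟩))
    · exact ⟨none, fun i => iff_of_false (Option.some_ne_none i).symm fun hi => h ⟨i, hi⟩⟩
  choose c hc using hassign
  exact ⟨c, fun i => Finset.ext fun n => mem_members.trans (hc n i)⟩

theorem IsFeasible.exists_image_members_eq_groups (hΛ : IsFeasible B Λ) {ι : Type} [Fintype ι]
    [DecidableEq ι] (hι : Fintype.card ι = numGroups Λ) :
    ∃ c : Fin N → Option ι, Finset.univ.image (members c) = groups Λ := by
  classical
  obtain ⟨e⟩ : Nonempty (ι ≃ {i // Matrix.row Λ i ≠ 0}) := by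
    rw [← Fintype.card_eq, hι, numGroups, Fintype.card_subtype]
  obtain ⟨c, hc⟩ := exists_members_eq (T := fun i => group Λ (e i)) fun i j hij =>
    hΛ.disjoint_group fun h => hij (e.injective (Subtype.ext h))
  refine ⟨c, Finset.ext fun T => ?_⟩
  simp only [Finset.mem_image, Finset.mem_univ, true_and, hc, mem_groups, e.exists_congr_left,
    e.apply_symm_apply, Subtype.exists, exists_prop]

end Grouping

/-! ### The capacity -/

section Capacity

theorem one_add_eta {N : ℕ} (K : ℕ) [NeZero K] (X : Finset (Fin N)) :
    1 + eta K X = ∑ i ∈ Finset.range K, (1 / (Xᶜ.card : ℝ)) ^ i := by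
  have hcard : (N : ℝ) - X.card = Xᶜ.card := by
    rw [Finset.card_compl, Nat.cast_sub X.card_le_univ, Fintype.card_fin]
  rw [eta, etaT, hcard, Nat.cast_one, Finset.range_eq_Ico,
    Finset.sum_eq_sum_Ico_succ_bot (NeZero.pos K), pow_zero]

variable {F : Type} [Field F] [Fintype F] {N K M : ℕ} [NeZero K] [NeZero M]
  {B : Matrix (Fin N) (Fin M) ℕ}

theorem Scheme.IsAdmissible.rate_le (hB : IsBinary B) {g : ℕ} (hg : ∀ m, (link B m)ᶜ.card = g)
    {𝒯 : Finset (Finset (Fin N))} {σ : Scheme F N K} (hσ : σ.IsAdmissible (links B) 𝒯)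
    (k : Fin K) :
    σ.rate k ≤ lam B / (M * ∑ i ∈ Finset.range K, (1 / (g : ℝ)) ^ i) := by
  have hsecure : ∀ m, σ.SecureAgainst (link B m) := fun m =>
    hσ.secure_link _ (Finset.mem_image_of_mem _ (Finset.mem_univ m))
  have hlink : ∀ m, σ.L * ∑ i ∈ Finset.range K, (1 / (g : ℝ)) ^ i ≤
      ∑ n ∈ (link B m)ᶜ, entropy (Fintype.card F) σ.law (σ.A k n) := fun m => by
    rw [← hg m]
    exact σ.geom_sum_le_sum_entropy (hsecure m) hσ.private_single hσ.decodable k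
  have hM : (0 : ℝ) < M := Nat.cast_pos.2 (NeZero.pos M)
  rw [Scheme.rate, div_le_div_iff₀
    (σ.sum_entropy_answer_pos (hsecure 0) hσ.private_single hσ.decodable k)
    (mul_pos hM (sum_one_div_pow_pos g K))]
  calc (σ.L : ℝ) * (M * ∑ i ∈ Finset.range K, (1 / (g : ℝ)) ^ i)
      = ∑ _ : Fin M, σ.L * ∑ i ∈ Finset.range K, (1 / (g : ℝ)) ^ i := by
        rw [Finset.sum_const, Finset.card_univ, Fintype.card_fin, nsmul_eq_mul, mul_left_comm]
    _ ≤ ∑ m, ∑ n ∈ (link B m)ᶜ, entropy (Fintype.card F) σ.law (σ.A k n) :=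
        Finset.sum_le_sum fun m _ => hlink m
    _ ≤ lam B * ∑ n, entropy (Fintype.card F) σ.law (σ.A k n) :=
        sum_sum_compl_link_le hB fun n => entropy_nonneg _ _ _

theorem isCapacity_of_lam_mul_eq (F : Type) [Field F] [Fintype F] (K : ℕ) [NeZero K]
    (hB : IsBinary B) {G : Type} [AddCommGroup G] [Fintype G] [DecidableEq G]
    {c : Fin N → Option G} {s : ℕ} (hs : ∀ i, (members c i).card = s) (hs2 : 2 ≤ s)
    (hlam : lam B * s = M) (hlink : ∀ m, (link B m)ᶜ.card = Fintype.card G)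
    (hsub : ∀ m i, ¬members c i ⊆ link B m) {𝒯 : Finset (Finset (Fin N))}
    (h𝒯 : ∀ T ∈ 𝒯, ∃ i, T ⊆ members c i) :
    IsCapacity F N K (links B) 𝒯
      (lam B / (M * ∑ i ∈ Finset.range K, (1 / (Fintype.card G : ℝ)) ^ i)) := by
  refine ⟨fun R ⟨σ, hσ, hR⟩ => (hR 0).trans (hσ.rate_le hB hlink 0), fun R hR => ?_⟩
  have hlam0 : (lam B : ℝ) ≠ 0 :=
    Nat.cast_ne_zero.2 (left_ne_zero_of_mul (hlam.trans_ne (NeZero.ne M)))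
  have hM : (M : ℝ) = lam B * s := by exact_mod_cast hlam.symm
  have h𝒳 : ∀ X ∈ links B, ∀ i, ¬members c i ⊆ X := Finset.forall_mem_image.2 fun m _ => hsub m
  calc (lam B : ℝ) / (M * ∑ i ∈ Finset.range K, (1 / (Fintype.card G : ℝ)) ^ i)
      = (s * ∑ i ∈ Finset.range K, (1 / (Fintype.card G : ℝ)) ^ i)⁻¹ := by
        rw [hM, mul_assoc, div_mul_cancel_left₀ hlam0]
    _ ≤ R := le_of_mem_upperBounds_achievableRates hs hs2 h𝒳 h𝒯 hR

theorem IsFeasible.isCapacity (F : Type) [Field F] [Fintype F] (K : ℕ) [NeZero K]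
    (hB : IsBinary B) {Λ : SimilarityMatrix N} (hΛ : IsFeasible B Λ) (hΛ0 : 0 < numGroups Λ)
    (hlam : (lam B : ℝ) / M = numGroups Λ / (∑ i, (group Λ i).card : ℕ))
    (hlink : ∀ m, (link B m)ᶜ.card = numGroups Λ) :
    IsCapacity F N K (links B) (groups Λ)
      (lam B / (M * ∑ i ∈ Finset.range K, (1 / (numGroups Λ : ℝ)) ^ i)) := by
  have : NeZero (numGroups Λ) := ⟨hΛ0.ne'⟩
  have hG : Fintype.card (ZMod (numGroups Λ)) = numGroups Λ := ZMod.card _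
  obtain ⟨c, hc⟩ := hΛ.exists_image_members_eq_groups hG
  have hmem : ∀ i, members c i ∈ groups Λ := fun i =>
    hc ▸ Finset.mem_image_of_mem _ (Finset.mem_univ i)
  have hsize : ∀ i, lam B * (members c i).card = M := fun i => hΛ.lam_mul_card hB hlam (hmem i)
  have hlam0 : 0 < lam B := Nat.pos_of_mul_pos_right ((NeZero.pos M).trans_eq (hsize 0).symm)
  rw [← hG] at hlink
  have hcap := isCapacity_of_lam_mul_eq F K hB (𝒯 := groups Λ)
    (fun i => Nat.eq_of_mul_eq_mul_left hlam0 ((hsize i).trans (hsize 0).symm))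
    (hΛ.two_le_card hB (hmem 0)) (hsize 0) hlink (fun m i => hΛ.not_subset_link hB (hmem i) m)
    (hc ▸ Finset.forall_mem_image.2 fun i _ => ⟨i, subset_rfl⟩)
  rwa [hG] at hcap

end Capacity

end

end AXPIR

theorem theorem4 (F : Type) [Field F] [Fintype F] (N K M : ℕ) [NeZero K] [NeZero M]
    (B : Matrix (Fin N) (Fin M) ℕ) (hB : AXPIR.IsBinary B)
    (Λ : AXPIR.SimilarityMatrix N) (hΛ : AXPIR.IsOptimalGrouping B Λ)
    (g : ℕ) (hg : g = AXPIR.numGroups Λ) (hg0 : 0 < g)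
    (hlam : (AXPIR.lam B : ℝ) / (M : ℝ) = (g : ℝ) / ((∑ i, (AXPIR.group Λ i).card : ℕ) : ℝ))
    (hX : ∀ m, (AXPIR.link B m).card = N - g) :
    AXPIR.IsCapacity F N K (AXPIR.links B) (AXPIR.groups Λ)
        ((AXPIR.lam B : ℝ) / ((M : ℝ) * (1 + AXPIR.eta K (AXPIR.link B 0)))) ∧
      (AXPIR.lam B : ℝ) / ((M : ℝ) * (1 + AXPIR.eta K (AXPIR.link B 0))) =
        (AXPIR.lam B : ℝ) / (M : ℝ) * AXPIR.CPIR (N - (AXPIR.link B 0).card) K ∧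
      (AXPIR.lam B : ℝ) / (M : ℝ) * AXPIR.CPIR (N - (AXPIR.link B 0).card) K =
        (AXPIR.lam B : ℝ) / (M : ℝ) * AXPIR.CPIR g K := by
  have hgN : g ≤ N := hg ▸ AXPIR.numGroups_le Λ
  have hcompl : ∀ m, (AXPIR.link B m)ᶜ.card = g := fun m => by
    rw [Finset.card_compl, Fintype.card_fin, hX, Nat.sub_sub_self hgN]
  have hlink : N - (AXPIR.link B 0).card = g := by rw [hX, Nat.sub_sub_self hgN]
  rw [AXPIR.one_add_eta, hcompl, hlink]
  subst hg
  exact ⟨hΛ.1.isCapacity F K hB hg0 hlam hcompl,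
    by rw [AXPIR.CPIR, ← div_eq_mul_inv, div_div], rfl⟩
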